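/- **Setting.** Let $X_{t+1}=AX_t+BU_t+W_t$, $Y_t=CX_t+\nu_t$ with $X_t\in\mathbb R^n$, $U_t\in\mathbb R^m$, $Y_t\in\mathbb R^p$, where $X_0\sim\mathcal N(\mu_0,\Sigma_x)$, $W_t\sim\mathcal N(0,\mathcal W)$, $\nu_t\sim\mathcal N(0,\mathcal V)$ $(t\ge 0)$ are mutually independent. There are $M$ quantizers. The $i$-th one has a finite measurable partition $\{\mathcal P^i_1,\dots,\mathcal P^i_{\ell_i}\}$ of $\mathbb R^p$ and distinct points $q^i_1,\dots,q^i_{\ell_i}\in\mathbb R^p$, with $g_i(y)=q^i_j$ iff $y\in\mathcal P^i_j$; it has a price $\lambda_i\ge 0$ and the delay $d_i=\lceil \log_2\ell_i/r_b\rceil$, where $r_b>0$ is the bit rate of the channel. At each time $t$ exactly one quantizer $i$ is selected ($\theta^i_t=1$ and $\theta^k_t=0$ for $k\ne i$); it quantizes the innovation $\xi_t=Y_t-\mathsf E[Y_t\mid Y_0,\dots,Y_{t-1},U_0,\dots,U_{t-1}]$, and the message $(g_i(\xi_t),i)$ reaches the controller at time $t+d_i$. Let $\hat O_t$ be the set of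 messages that arrive at time $t$. An admissible control strategy $\gamma^{\mathcal U}$ takes $U_t$ to be a measurable function of $\hat O_0,\dots,\hat O_t,U_0,\dots,U_{t-1}$; an admissible selection strategy $\gamma^\Theta$ takes $\theta_t$ to be a measurable function of $\hat O_0,\dots,\hat O_{t-1},\theta_0,\dots,\theta_{t-1}$. A pair $(\gamma^{\mathcal U},\gamma^\Theta)$ is optimal if it minimizes, among all admissible pairs, $$J(\gamma^{\mathcal U},\gamma^\Theta)=\mathsf E\Big[\sum_{t=0}^{T-1}\Big(X_t^{\mathsf T}Q_1X_t+U_t^{\mathsf T}RU_t+\sum_{i=1}^M\theta^i_t\lambda_i\Big)+X_T^{\mathsf T}Q_2X_T\Big],$$ where $Q_1,Q_2\succeq 0$ and $R\succ 0$. The $j$-th quantizer is *optimal at time $t$* if some optimal pair of strategies selects it at time $t$ almost surely. **Offline quantities.** Let $\Sigma_{0|-1}=\Sigma_x$, $M_t=C\Sigma_{t|t-1}C^{\mathsf T}+\mathcal V$, $\Sigma_t=\Sigma_{t|t-1}-\Sigma_{t|t-1}C^{\mathsf T}M_t^{-1}C\Sigma_{t|t-1}$, $\Sigma_{t+1|t}=A\Sigma_tA^{\mathsf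 T}+\mathcal W$, and assume that $M_t$ is invertible for $t<T$. Let $P_T=Q_2$ and, for $k<T$, $L_k=(R+B^{\mathsf T}P_{k+1}B)^{-1}B^{\mathsf T}P_{k+1}A$, $N_k=L_k^{\mathsf T}(R+B^{\mathsf T}P_{k+1}B)L_k$, $P_k=Q_1+A^{\mathsf T}P_{k+1}A-N_k$. For $t\le\ell<T$ let $\Psi(\ell,t)=A^{\ell-t}\Sigma_{t|t-1}C^{\mathsf T}M_t^{-1}$ and $\tilde N_{t,\ell}=\Psi(\ell,t)^{\mathsf T}N_\ell\Psi(\ell,t)$. Let $[\Phi]_{s,i}=1$ if $s\ge d_i$ and $[\Phi]_{s,i}=0$ otherwise. With $\zeta\sim\mathcal N(0,M_t)$ let $$F^i_t=\sum_{j=1}^{\ell_i}\mathsf P(\zeta\in\mathcal P^i_j)\,\mathsf E[\zeta\mid\zeta\in\mathcal P^i_j]\,\mathsf E[\zeta\mid\zeta\in\mathcal P^i_j]^{\mathsf T}$$ (cells of probability $0$ are omitted), and $$c^i_t=\lambda_i-\operatorname{tr}\Big(\Big(\sum_{\ell=t}^{T-1}[\Phi]_{\ell-t,i}\tilde N_{t,\ell}\Big)F^i_t\Big).$$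 **Theorem.** For each $t\in\{0,\dots,T-1\}$, the $j$-th quantizer is optimal at time $t$ if and only if $c^j_t=\min\{c^1_t,\dots,c^M_t\}$. Moreover, an admissible selection strategy $\gamma^\Theta$ belongs to an optimal pair if and only if, whatever the admissible control strategy $\gamma^{\mathcal U}$, at every time $t<T$ it almost surely selects a quantizer $i$ with $c^i_t=\min\{c^1_t,\dots,c^M_t\}$. In particular, the selection can be computed offline, independently of the controller. -/

import Mathlib

open MeasureTheory ProbabilityTheory Matrix

namespace QFLQG

/-- Column vectors in `ℝᵏ`. -/
abbrev Vec (k : ℕ) := Fin k → ℝ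

/-- The Gaussian law `N(μ, S)` on `ℝᵏ` (for positive semidefinite, possibly singular `S`). -/
noncomputable def gaussianVec {k : ℕ} (μ : Vec k) (S : Matrix (Fin k) (Fin k) ℝ) :
    Measure (Vec k) :=
  (multivariateGaussian (WithLp.toLp 2 μ) S).map (fun x => WithLp.ofLp x)

/-- A quantizer on `ℝᵖ`: finitely many distinct quantization points `q₁, …, q_ℓ`, and a partition
of `ℝᵖ` into measurable cells, given by the measurable map `idx` that sends a vector to the label
of its cell. -/
structure Quantizer (p : ℕ) where
  levels : ℕ
  point : Fin levels → Vec p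
  point_injective : Function.Injective point
  idx : Vec p → Fin levels
  measurable_idx : Measurable idx

/-- The `j`-th cell of the partition. -/
def Quantizer.cell {p : ℕ} (q : Quantizer p) (j : Fin q.levels) : Set (Vec p) :=
  {y | q.idx y = j}

/-- The quantization map `g`: `g y = q_j` if and only if `y` lies in the `j`-th cell. -/
def Quantizer.quantize {p : ℕ} (q : Quantizer p) (y : Vec p) : Vec p := q.point (q.idx y)

/-- The data of a partially observed quantized-feedback LQG problem with state dimension `n`,
control dimension `m`, output dimension `p` and `M` available quantizers. -/
structure Problem (n m p M : ℕ) where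
  /-- the horizon -/
  T : ℕ
  A : Matrix (Fin n) (Fin n) ℝ
  B : Matrix (Fin n) (Fin m) ℝ
  C : Matrix (Fin p) (Fin n) ℝ
  /-- covariance of the process noise -/
  covW : Matrix (Fin n) (Fin n) ℝ
  /-- covariance of the measurement noise -/
  covV : Matrix (Fin p) (Fin p) ℝ
  /-- mean and covariance of the initial state -/
  mean0 : Vec n
  cov0 : Matrix (Fin n) (Fin n) ℝ
  Q1 : Matrix (Fin n) (Fin n) ℝ
  Q2 : Matrix (Fin n) (Fin n) ℝ
  R : Matrix (Fin m) (Fin m) ℝ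
  quantizer : Fin M → Quantizer p
  /-- the price `λ i` of one use of the `i`-th quantizer -/
  price : Fin M → ℝ
  /-- bit rate of the channel -/
  bitRate : ℝ
  covW_psd : covW.PosSemidef
  covV_psd : covV.PosSemidef
  cov0_psd : cov0.PosSemidef
  Q1_psd : Q1.PosSemidef
  Q2_psd : Q2.PosSemidef
  R_pd : R.PosDef
  price_nonneg : ∀ i, 0 ≤ price i
  bitRate_pos : 0 < bitRate

/-- The primitive random variables: initial state, process noise and measurement noise.
The three independence clauses together say that all of `X₀, W₀, W₁, …, ν₀, ν₁, …` are mutually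
independent. -/
structure Noise {n m p M : ℕ} (S : Problem n m p M) {Ω : Type*} [MeasurableSpace Ω]
    (P : Measure Ω) where
  X0 : Ω → Vec n
  W : ℕ → Ω → Vec n
  V : ℕ → Ω → Vec p
  measurable_X0 : Measurable X0
  measurable_W : ∀ t, Measurable (W t)
  measurable_V : ∀ t, Measurable (V t)
  law_X0 : P.map X0 = gaussianVec S.mean0 S.cov0
  law_W : ∀ t, P.map (W t) = gaussianVec 0 S.covW
  law_V : ∀ t, P.map (V t) = gaussianVec 0 S.covV
  indep_W : iIndepFun W P
  indep_V : iIndepFun V P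
  indep_W_V : IndepFun (fun ω t => W t ω) (fun ω t => V t ω) P
  indep_X0 : IndepFun X0 (fun ω => ((fun t => W t ω), (fun t => V t ω))) P

/-- What arrives at the controller at one instant: the `i`-th entry is `(true, q)` if the message
`(q, i)` arrives, and `(false, 0)` if nothing quantized by the `i`-th quantizer arrives. -/
abbrev Obs (p M : ℕ) := Fin M → Bool × Vec p

/-- An admissible control strategy: `U_t` is a measurable function of `Ô₀, …, Ô_t` and
`U₀, …, U_{t-1}`. -/
structure ControlPolicy (m p M : ℕ) where
  act : ∀ t : ℕ, (Fin (t + 1) → Obs p M) × (Fin t → Vec m) → Vec m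
  measurable_act : ∀ t, Measurable (act t)

/-- An admissible quantizer-selection strategy: the index of the quantizer used at time `t` is a
measurable function of `Ô₀, …, Ô_{t-1}` and of the indices chosen at times `0, …, t-1`. Exactly one
quantizer is used at each time, so the selection vector `θ_t` is the indicator of this index. -/
structure SelectorPolicy (p M : ℕ) where
  act : ∀ t : ℕ, (Fin t → Obs p M) × (Fin t → Fin M) → Fin M
  measurable_act : ∀ t, Measurable (act t)

/-- All signals of the loop at one instant, as random variables: state, output, innovation,
index of the selected quantizer, data arriving at the controller, control. -/
structure Signals (n m p M : ℕ) (Ω : Type*) where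
  X : Ω → Vec n
  Y : Ω → Vec p
  ξ : Ω → Vec p
  sel : Ω → Fin M
  O : Ω → Obs p M
  U : Ω → Vec m

namespace Problem

variable {n m p M : ℕ} (S : Problem n m p M)

/-- The delay `d_i = ⌈log₂ ℓ_i / r_b⌉` of the `i`-th quantizer. -/
noncomputable def delay (i : Fin M) : ℕ :=
  ⌈Real.logb 2 (S.quantizer i).levels / S.bitRate⌉₊

/-- The data arriving at time `t`, given the innovations and the selected indices up to time `t`:
the value of `ξ_{t - d_i}` quantized by the `i`-th quantizer arrives at time `t` if and only if
`t ≥ d_i` and the `i`-th quantizer was selected at time `t - d_i`. -/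
noncomputable def arrivals (t : ℕ) (ξ : Fin (t + 1) → Vec p) (sel : Fin (t + 1) → Fin M) :
    Obs p M := fun i =>
  if S.delay i ≤ t ∧ sel ⟨t - S.delay i, by omega⟩ = i then
    (true, (S.quantizer i).quantize (ξ ⟨t - S.delay i, by omega⟩))
  else (false, 0)

section ClosedLoop

variable {Ω : Type*} [MeasurableSpace Ω] {P : Measure Ω} (noise : Noise S P)

/-- The state at time `t`, from the signals at earlier times: `X_{t+1} = A X_t + B U_t + W_t`. -/
def nextState : (t : ℕ) → (Fin t → Signals n m p M Ω) → Ω → Vec n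
  | 0, _ => noise.X0
  | t + 1, h => fun ω =>
      S.A *ᵥ (h (Fin.last t)).X ω + S.B *ᵥ (h (Fin.last t)).U ω + noise.W t ω

/-- The `σ`-algebra generated by the earlier outputs and controls. -/
abbrev pastSigma {t : ℕ} (h : Fin t → Signals n m p M Ω) : MeasurableSpace Ω :=
  ⨆ s : Fin t, MeasurableSpace.comap (h s).Y inferInstance ⊔
    MeasurableSpace.comap (h s).U inferInstance

/-- One step of the closed loop: the signals at time `t` from those at times `0, …, t-1`.
The innovation is `ξ_t = Y_t - E[Y_t | Y₀, …, Y_{t-1}, U₀, …, U_{t-1}]`. -/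
noncomputable def step (γU : ControlPolicy m p M) (γΘ : SelectorPolicy p M) (t : ℕ)
    (h : Fin t → Signals n m p M Ω) : Signals n m p M Ω :=
  let X : Ω → Vec n := S.nextState noise t h
  let Y : Ω → Vec p := fun ω => S.C *ᵥ X ω + noise.V t ω
  let ξ : Ω → Vec p := Y - P[Y | pastSigma h]
  let sel : Ω → Fin M := fun ω => γΘ.act t (fun s => (h s).O ω, fun s => (h s).sel ω)
  let O : Ω → Obs p M := fun ω => S.arrivals t
    (Fin.snoc (α := fun _ => Vec p) (fun s => (h s).ξ ω) (ξ ω))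
    (Fin.snoc (α := fun _ => Fin M) (fun s => (h s).sel ω) (sel ω))
  let U : Ω → Vec m := fun ω => γU.act t
    (Fin.snoc (α := fun _ => Obs p M) (fun s => (h s).O ω) (O ω), fun s => (h s).U ω)
  ⟨X, Y, ξ, sel, O, U⟩

/-- The closed loop under the strategies `γU` and `γΘ`. -/
noncomputable def closedLoop (γU : ControlPolicy m p M) (γΘ : SelectorPolicy p M) (t : ℕ) :
    Signals n m p M Ω :=
  S.step noise γU γΘ t (fun s : Fin t => closedLoop γU γΘ s)
termination_by t
decreasing_by exact s.2

/-- The cost `J(γU, γΘ)`. The controls take finitely many values and the noises are Gaussian, so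
the integrand is integrable for all admissible strategies. -/
noncomputable def J (γU : ControlPolicy m p M) (γΘ : SelectorPolicy p M) : ℝ :=
  let Z := S.closedLoop noise γU γΘ
  ∫ ω, ((∑ t ∈ Finset.range S.T,
      ((Z t).X ω ⬝ᵥ S.Q1 *ᵥ (Z t).X ω + (Z t).U ω ⬝ᵥ S.R *ᵥ (Z t).U ω
        + S.price ((Z t).sel ω)))
      + (Z S.T).X ω ⬝ᵥ S.Q2 *ᵥ (Z S.T).X ω) ∂P

/-- `(γU, γΘ)` minimizes the cost among all pairs of admissible strategies. -/
def IsOptimal (γU : ControlPolicy m p M) (γΘ : SelectorPolicy p M) : Prop :=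
  ∀ (γU' : ControlPolicy m p M) (γΘ' : SelectorPolicy p M),
    S.J noise γU γΘ ≤ S.J noise γU' γΘ'

/-- The `j`-th quantizer is optimal at time `t`: some optimal pair of strategies uses it then. -/
def IsOptimalQuantizer (t : ℕ) (j : Fin M) : Prop :=
  ∃ (γU : ControlPolicy m p M) (γΘ : SelectorPolicy p M), S.IsOptimal noise γU γΘ ∧
    ∀ᵐ ω ∂P, (S.closedLoop noise γU γΘ t).sel ω = j

end ClosedLoop

/-- The prediction error covariance `Σ_{t|t-1}`; here `Σ_{0|-1}` is the covariance of `X₀`,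
`Σ_{t+1|t} = A Σ_t Aᵀ + 𝒲` and
`Σ_t = Σ_{t|t-1} - Σ_{t|t-1} Cᵀ (C Σ_{t|t-1} Cᵀ + 𝒱)⁻¹ C Σ_{t|t-1}`. -/
noncomputable def predCov : ℕ → Matrix (Fin n) (Fin n) ℝ
  | 0 => S.cov0
  | t + 1 =>
      S.A * (predCov t - predCov t * S.Cᵀ * (S.C * predCov t * S.Cᵀ + S.covV)⁻¹
        * S.C * predCov t) * S.Aᵀ + S.covW

/-- The innovation covariance `M_t = C Σ_{t|t-1} Cᵀ + 𝒱`. -/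
noncomputable def innovCov (t : ℕ) : Matrix (Fin p) (Fin p) ℝ :=
  S.C * S.predCov t * S.Cᵀ + S.covV

/-- `Ψ(t, k) = A^{t-k} Σ_{k|k-1} Cᵀ M_k⁻¹`, for `k ≤ t`. -/
noncomputable def Psi (t k : ℕ) : Matrix (Fin n) (Fin p) ℝ :=
  S.A ^ (t - k) * S.predCov k * S.Cᵀ * (S.innovCov k)⁻¹

/-- The gain `(R + Bᵀ P B)⁻¹ Bᵀ P A` belonging to the cost-to-go matrix `P`. -/
noncomputable def gainOf (P : Matrix (Fin n) (Fin n) ℝ) : Matrix (Fin m) (Fin n) ℝ :=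
  (S.R + S.Bᵀ * P * S.B)⁻¹ * S.Bᵀ * P * S.A

/-- The Riccati recursion backwards in time: `riccati s` is the cost-to-go matrix with `s` steps
left. -/
noncomputable def riccati : ℕ → Matrix (Fin n) (Fin n) ℝ
  | 0 => S.Q2
  | s + 1 =>
      S.Q1 + S.Aᵀ * riccati s * S.A
        - (S.gainOf (riccati s))ᵀ * (S.R + S.Bᵀ * riccati s * S.B) * S.gainOf (riccati s)

/-- `P_k`, for `k ≤ T`, with `P_T = Q2`. -/
noncomputable def costToGo (k : ℕ) : Matrix (Fin n) (Fin n) ℝ := S.riccati (S.T - k)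

/-- `L_k = (R + Bᵀ P_{k+1} B)⁻¹ Bᵀ P_{k+1} A`, for `k < T`. -/
noncomputable def gain (k : ℕ) : Matrix (Fin m) (Fin n) ℝ := S.gainOf (S.costToGo (k + 1))

/-- `N_k = L_kᵀ (R + Bᵀ P_{k+1} B) L_k`, for `k < T`. -/
noncomputable def weightN (k : ℕ) : Matrix (Fin n) (Fin n) ℝ :=
  (S.gain k)ᵀ * (S.R + S.Bᵀ * S.costToGo (k + 1) * S.B) * S.gain k

/-- `Ñ_{t,ℓ} = Ψ(ℓ, t)ᵀ N_ℓ Ψ(ℓ, t)`, for `t ≤ ℓ < T`. -/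
noncomputable def weightNtilde (t l : ℕ) : Matrix (Fin p) (Fin p) ℝ :=
  (S.Psi l t)ᵀ * S.weightN l * S.Psi l t

/-- The delay indicator `Φ_{s,i}`: it is `1` if `s ≥ d_i` and `0` otherwise. -/
noncomputable def Phi (s : ℕ) (i : Fin M) : ℝ := if S.delay i ≤ s then 1 else 0

/-- `E[ξ | ξ ∈ cell j of quantizer i]` for `ξ` with law `N(0, M_t)`. -/
noncomputable def cellMean (t : ℕ) (i : Fin M) (j : Fin (S.quantizer i).levels) : Vec p :=
  ∫ x, x ∂((gaussianVec 0 (S.innovCov t))[|(S.quantizer i).cell j])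

/-- `F^i_t = ∑_j P(ξ ∈ cell j) E[ξ | ξ ∈ cell j] E[ξ | ξ ∈ cell j]ᵀ` for `ξ` with law `N(0, M_t)`;
cells of probability zero contribute nothing. -/
noncomputable def covReduction (t : ℕ) (i : Fin M) : Matrix (Fin p) (Fin p) ℝ :=
  ∑ j : Fin (S.quantizer i).levels,
    (gaussianVec 0 (S.innovCov t)).real ((S.quantizer i).cell j) •
      vecMulVec (S.cellMean t i j) (S.cellMean t i j)

/-- `c^i_t = λ_i - tr((∑_{ℓ=t}^{T-1} Φ_{ℓ-t,i} Ñ_{t,ℓ}) F^i_t)`. -/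
noncomputable def c (t : ℕ) (i : Fin M) : ℝ :=
  S.price i -
    ((∑ l ∈ Finset.Ico t S.T, S.Phi (l - t) i • S.weightNtilde t l) * S.covReduction t i).trace

end Problem

end QFLQG

/-!
# Optimal quantizer selection in quantized-feedback LQG control

Under any pair of strategies the state is `X_t = err_t + predMean_t`, where `err_t`, the prediction
error of the Kalman filter, involves the noises only, and where the predicted mean is a function of
the earlier innovations and controls. The innovations of the Kalman filter are Gaussian and
independent of each other (`Noise.law_err`, `Noise.indepFun_past_innov`), and the innovations of the
closed loop agree with them almost surely (`closedLoop_ξ_ae_eq`). So neither strategy influences the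
innovations, and all signals are deterministic functions (`selOf`, `obsOf`, `ctrlOf`) of one fixed
sequence of independent vectors; selections and arriving data do not involve the control strategy
at all.

Completing the squares with the Riccati matrices turns the cost into a constant, plus the prices,
plus the mean squares of the deviations of `U_t` from `-L_t E[X_t | Y₀, …, Y_t]` (`J_eq`). This
conditional mean is affine in the innovations. Replace each innovation by its conditional mean given
the data received: the centroid of its cell if its message has arrived, and `0` otherwise. The
estimation errors are orthogonal to all functions of the data, and to each other
(`integral_estError_dotProduct`), because changing an innovation within its cell changes nothing
that is observed. Hence the deviation splits (`integral_ctrlDev_sq`), and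
`J = minCost + ctrlExcess + selExcess` (`J_eq_minCost_add`). Here `ctrlExcess ≥ 0` measures the
distance from the certainty-equivalent control, and `selExcess = ∑ t, E[c_t(σ_t) - min c_t] ≥ 0`,
for the selected indices `σ_t`, depends on the selection strategy alone.

The certainty-equivalent controller `certainty` decodes the data without knowing the selection
strategy, and has `ctrlExcess = 0` against every selection strategy; choosing a minimizer of `c_t` at
each time gives `selExcess = 0`. So a pair is optimal iff both excesses vanish (`isOptimal_iff`),
and `selExcess = 0` says that the selection almost surely minimizes `c_t` at every time `t < T`.
-/

namespace QFLQG

/-! ### Gaussian vectors -/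

section Gaussian

variable {Ω : Type*} [MeasurableSpace Ω] {P : Measure Ω} {j k l : ℕ}

lemma measurable_const_mulVec (H : Matrix (Fin l) (Fin k) ℝ) {f : Ω → Vec k} (hf : Measurable f) :
    Measurable fun ω => H *ᵥ f ω :=
  (Continuous.matrix_mulVec continuous_const continuous_id).measurable.comp hf

lemma measurable_dotProduct {f g : Ω → Vec k} (hf : Measurable f) (hg : Measurable g) :
    Measurable fun ω => f ω ⬝ᵥ g ω := by
  unfold dotProduct
  fun_prop

lemma PosSemidef.symm {H : Matrix (Fin k) (Fin k) ℝ} (h : H.PosSemidef) : Hᵀ = H := by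
  simpa using h.isHermitian.eq

lemma PosSemidef.nonneg {H : Matrix (Fin k) (Fin k) ℝ} (h : H.PosSemidef) (x : Vec k) :
    0 ≤ x ⬝ᵥ H *ᵥ x := by
  simpa using h.dotProduct_mulVec_nonneg x

lemma mulVec_dotProduct_comm (H : Matrix (Fin l) (Fin k) ℝ) (x : Vec k) (y : Vec l) :
    H *ᵥ x ⬝ᵥ y = x ⬝ᵥ Hᵀ *ᵥ y := by
  rw [mulVec_transpose, dotProduct_comm, dotProduct_mulVec, dotProduct_comm]

instance isGaussian_gaussianVec (μ : Vec k) (S : Matrix (Fin k) (Fin k) ℝ) :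
    IsGaussian (gaussianVec μ S) := by
  have : (fun x : EuclideanSpace ℝ (Fin k) => WithLp.ofLp x) =
    ((EuclideanSpace.equiv (Fin k) ℝ).toContinuousLinearMap) := rfl
  unfold gaussianVec
  rw [this]
  infer_instance

lemma integral_gaussianVec (μ : Vec k) (S : Matrix (Fin k) (Fin k) ℝ) :
    ∫ x, x ∂(gaussianVec μ S) = μ := by
  have h : (fun x : EuclideanSpace ℝ (Fin k) => WithLp.ofLp x) =
    ((EuclideanSpace.equiv (Fin k) ℝ).toContinuousLinearMap) := rfl
  unfold gaussianVec
  rw [integral_map (by fun_prop) (by fun_prop), h,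
    ContinuousLinearMap.integral_comp_comm _ IsGaussian.integrable_fun_id,
    integral_id_multivariateGaussian]
  rfl

lemma integral_cexp_gaussianVec (μ : Vec k) {S : Matrix (Fin k) (Fin k) ℝ} (hS : S.PosSemidef)
    (a : Vec k) :
    ∫ x, Complex.exp ((a ⬝ᵥ x : ℝ) * Complex.I) ∂(gaussianVec μ S) =
      Complex.exp ((a ⬝ᵥ μ : ℝ) * Complex.I - (a ⬝ᵥ S *ᵥ a : ℝ) / 2) := by
  have h := charFun_multivariateGaussian (μ := WithLp.toLp 2 μ) hS (WithLp.toLp 2 a)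
  rw [charFun_apply] at h
  simp only [EuclideanSpace.inner_eq_star_dotProduct, star_trivial] at h
  unfold gaussianVec
  rw [integral_map (by fun_prop)]
  · rw [h, dotProduct_comm μ a]
  · refine Continuous.aestronglyMeasurable ?_
    unfold dotProduct
    fun_prop

lemma dual_eq_dotProduct (L : StrongDual ℝ (Vec k)) (x : Vec k) :
    L x = (fun i => L (Pi.single i 1)) ⬝ᵥ x := by
  conv_lhs => rw [← Finset.univ_sum_single x]
  rw [map_sum]
  refine Finset.sum_congr rfl fun i _ => ?_
  have : (Pi.single i (x i) : Vec k) = x i • Pi.single i 1 := by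
    rw [← Pi.single_smul]; simp
  rw [this, map_smul, smul_eq_mul, mul_comm]

/-- A random vector with the characteristic function of a Gaussian vector is Gaussian. -/
lemma map_eq_gaussianVec [IsProbabilityMeasure P] {X : Ω → Vec k} (hX : Measurable X)
    {S : Matrix (Fin k) (Fin k) ℝ} (hS : S.PosSemidef)
    (h : ∀ a : Vec k, ∫ ω, Complex.exp ((a ⬝ᵥ X ω : ℝ) * Complex.I) ∂P =
      Complex.exp (-(a ⬝ᵥ S *ᵥ a : ℝ) / 2)) :
    P.map X = gaussianVec 0 S := by
  have := Measure.isProbabilityMeasure_map (μ := P) hX.aemeasurable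
  refine Measure.ext_of_charFunDual (funext fun L => ?_)
  obtain ⟨a, ha⟩ : ∃ a : Vec k, ∀ x, L x = a ⬝ᵥ x := ⟨_, dual_eq_dotProduct L⟩
  simp only [charFunDual_apply, ha]
  rw [integral_cexp_gaussianVec 0 hS, integral_map hX.aemeasurable, h]
  · rw [dotProduct_zero, Complex.ofReal_zero, zero_mul, zero_sub, neg_div]
  · refine Continuous.aestronglyMeasurable ?_
    unfold dotProduct
    fun_prop

/-- If the joint characteristic function of two random vectors is that of a pair of independent
centred Gaussian vectors, then so is their joint law. -/
lemma indepFun_of_integral_cexp [IsProbabilityMeasure P] {X : Ω → Vec k} {Y : Ω → Vec l}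
    (hX : Measurable X) (hY : Measurable Y)
    {S₁ : Matrix (Fin k) (Fin k) ℝ} {S₂ : Matrix (Fin l) (Fin l) ℝ}
    (h : ∀ a b, ∫ ω, Complex.exp ((a ⬝ᵥ X ω + b ⬝ᵥ Y ω : ℝ) * Complex.I) ∂P =
      Complex.exp (-(a ⬝ᵥ S₁ *ᵥ a + b ⬝ᵥ S₂ *ᵥ b : ℝ) / 2)) :
    IndepFun X Y P := by
  rw [indepFun_iff_charFunDual_prod hX.aemeasurable hY.aemeasurable]
  intro L
  set a : Vec k := fun i => L (Pi.single i 1, 0) with ha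
  set b : Vec l := fun i => L (0, Pi.single i 1) with hb
  have h1 : ∀ x, L (x, 0) = a ⬝ᵥ x := fun x =>
    dual_eq_dotProduct (L ∘SL ContinuousLinearMap.inl ℝ (Vec k) (Vec l)) x
  have h2 : ∀ y, L (0, y) = b ⬝ᵥ y := fun y =>
    dual_eq_dotProduct (L ∘SL ContinuousLinearMap.inr ℝ (Vec k) (Vec l)) y
  have h3 : ∀ z : Vec k × Vec l, L z = a ⬝ᵥ z.1 + b ⬝ᵥ z.2 := fun z => by
    rw [← h1, ← h2, ← map_add]; simp
  simp only [charFunDual_apply, ContinuousLinearMap.comp_apply, ContinuousLinearMap.inl_apply,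
    ContinuousLinearMap.inr_apply, h1, h2]
  have hm : ∀ {i : ℕ} (c : Vec i), Continuous fun x : Vec i =>
      Complex.exp ((c ⬝ᵥ x : ℝ) * Complex.I) := by
    intro i c
    unfold dotProduct
    fun_prop
  rw [integral_map (hX.prodMk hY).aemeasurable, integral_map hX.aemeasurable
    (hm a).aestronglyMeasurable, integral_map hY.aemeasurable (hm b).aestronglyMeasurable]
  · have ha' := h a 0
    have hb' := h 0 b
    simp only [zero_dotProduct, add_zero, zero_add] at ha' hb'
    simp only [h3]
    rw [h, ha', hb', ← Complex.exp_add]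
    congr 1
    push_cast
    ring
  · refine Continuous.aestronglyMeasurable ?_
    fun_prop

lemma integral_cexp_of_indepFun {X : Ω → Vec k} {Y : Ω → Vec l}
    (hX : Measurable X) (hY : Measurable Y) (hXY : IndepFun X Y P)
    {S₁ : Matrix (Fin k) (Fin k) ℝ} {S₂ : Matrix (Fin l) (Fin l) ℝ} (h₁ : S₁.PosSemidef)
    (h₂ : S₂.PosSemidef) (lX : P.map X = gaussianVec 0 S₁) (lY : P.map Y = gaussianVec 0 S₂)
    (a : Vec k) (b : Vec l) :
    ∫ ω, Complex.exp ((a ⬝ᵥ X ω + b ⬝ᵥ Y ω : ℝ) * Complex.I) ∂P =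
      Complex.exp (-(a ⬝ᵥ S₁ *ᵥ a + b ⬝ᵥ S₂ *ᵥ b : ℝ) / 2) := by
  have hm : ∀ {i : ℕ} (c : Vec i), Continuous fun x : Vec i =>
      Complex.exp ((c ⬝ᵥ x : ℝ) * Complex.I) := by
    intro i c
    unfold dotProduct
    fun_prop
  have h := hXY.integral_fun_comp_mul_comp (𝕜 := ℂ) hX.aemeasurable hY.aemeasurable
    (hm a).aestronglyMeasurable (hm b).aestronglyMeasurable
  have e : ∀ ω, Complex.exp ((a ⬝ᵥ X ω + b ⬝ᵥ Y ω : ℝ) * Complex.I) =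
      Complex.exp ((a ⬝ᵥ X ω : ℝ) * Complex.I) * Complex.exp ((b ⬝ᵥ Y ω : ℝ) * Complex.I) := by
    intro ω
    rw [← Complex.exp_add]
    push_cast
    ring_nf
  simp only [e]
  rw [h, ← integral_map (φ := X) (f := fun x => Complex.exp ((a ⬝ᵥ x : ℝ) * Complex.I))
      hX.aemeasurable (hm a).aestronglyMeasurable,
    ← integral_map (φ := Y) (f := fun x => Complex.exp ((b ⬝ᵥ x : ℝ) * Complex.I))
      hY.aemeasurable (hm b).aestronglyMeasurable, lX, lY,
    integral_cexp_gaussianVec 0 h₁, integral_cexp_gaussianVec 0 h₂, ← Complex.exp_add]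
  congr 1
  simp
  ring

/-- The law of `A X + Y` for independent centred Gaussian vectors `X` and `Y`. -/
lemma map_linear_add_eq_gaussianVec [IsProbabilityMeasure P] {X : Ω → Vec k} {Y : Ω → Vec l}
    (hX : Measurable X) (hY : Measurable Y) (hXY : IndepFun X Y P)
    {S₁ : Matrix (Fin k) (Fin k) ℝ} {S₂ : Matrix (Fin l) (Fin l) ℝ} (h₁ : S₁.PosSemidef)
    (h₂ : S₂.PosSemidef) (lX : P.map X = gaussianVec 0 S₁) (lY : P.map Y = gaussianVec 0 S₂)
    (A : Matrix (Fin l) (Fin k) ℝ) :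
    P.map (fun ω => A *ᵥ X ω + Y ω) = gaussianVec 0 (A * S₁ * Aᵀ + S₂) := by
  have hm : Measurable fun ω => A *ᵥ X ω + Y ω := (measurable_const_mulVec A hX).add hY
  refine map_eq_gaussianVec hm ?_ fun a => ?_
  · exact (by simpa using h₁.mul_mul_conjTranspose_same A : (A * S₁ * Aᵀ).PosSemidef).add h₂
  · have h := integral_cexp_of_indepFun hX hY hXY h₁ h₂ lX lY (Aᵀ *ᵥ a) a
    have e : ∀ ω, a ⬝ᵥ (A *ᵥ X ω + Y ω) = (Aᵀ *ᵥ a) ⬝ᵥ X ω + a ⬝ᵥ Y ω := fun ω => by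
      rw [dotProduct_add, mulVec_dotProduct_comm, transpose_transpose]
    simp only [e]
    rw [h, mulVec_dotProduct_comm, transpose_transpose, add_mulVec, dotProduct_add,
      ← mulVec_mulVec, ← mulVec_mulVec]

/-- The measurement update of the Kalman filter: for independent `X ~ N(0, S)` and `V ~ N(0, Q)`
and a gain `K` with `K (C S Cᵀ + Q) = S Cᵀ`, the observation `C X + V` is independent of the
residual `X - K (C X + V)`, which has law `N(0, S - K C S)`. -/
lemma kalman_update [IsProbabilityMeasure P] {X : Ω → Vec k} {V : Ω → Vec l}
    (hX : Measurable X) (hV : Measurable V) (hXV : IndepFun X V P)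
    {S : Matrix (Fin k) (Fin k) ℝ} {Q : Matrix (Fin l) (Fin l) ℝ} (hS : S.PosSemidef)
    (hQ : Q.PosSemidef) (lX : P.map X = gaussianVec 0 S) (lV : P.map V = gaussianVec 0 Q)
    (C : Matrix (Fin l) (Fin k) ℝ) (K : Matrix (Fin k) (Fin l) ℝ)
    (hK : K * (C * S * Cᵀ + Q) = S * Cᵀ) :
    (S - K * C * S).PosSemidef ∧
    P.map (fun ω => X ω - K *ᵥ (C *ᵥ X ω + V ω)) = gaussianVec 0 (S - K * C * S) ∧
    IndepFun (fun ω => X ω - K *ᵥ (C *ᵥ X ω + V ω)) (fun ω => C *ᵥ X ω + V ω) P := by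
  set M := C * S * Cᵀ + Q with hM
  have hKt : M * Kᵀ = C * S := by
    have hMt : Mᵀ = M := by
      simp [hM, transpose_mul, PosSemidef.symm hS, PosSemidef.symm hQ, Matrix.mul_assoc]
    have := congrArg transpose hK
    rwa [transpose_mul, transpose_mul, transpose_transpose, hMt, PosSemidef.symm hS] at this
  have key : ∀ a b, ∫ ω, Complex.exp ((a ⬝ᵥ (X ω - K *ᵥ (C *ᵥ X ω + V ω)) +
      b ⬝ᵥ (C *ᵥ X ω + V ω) : ℝ) * Complex.I) ∂P =
      Complex.exp (-(a ⬝ᵥ (S - K * C * S) *ᵥ a + b ⬝ᵥ M *ᵥ b : ℝ) / 2) := by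
    intro a b
    set c := b - Kᵀ *ᵥ a with hc
    have h := integral_cexp_of_indepFun hX hV hXV hS hQ lX lV (a + Cᵀ *ᵥ c) c
    have e : ∀ ω, a ⬝ᵥ (X ω - K *ᵥ (C *ᵥ X ω + V ω)) + b ⬝ᵥ (C *ᵥ X ω + V ω) =
        (a + Cᵀ *ᵥ c) ⬝ᵥ X ω + c ⬝ᵥ V ω := fun ω => by
      rw [add_dotProduct, mulVec_dotProduct_comm, transpose_transpose, hc]
      simp only [sub_dotProduct, dotProduct_sub, mulVec_dotProduct_comm, transpose_transpose,
        dotProduct_add, mulVec_add]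
      ring
    simp only [e]
    rw [h]
    congr 3
    -- with `c = b - Kᵀ a`, the quadratic form of `(a, b)` is `aᵀ S a + 2 aᵀ S Cᵀ c + cᵀ M c`;
    -- its mixed terms cancel because `K M = S Cᵀ`
    have e1 : (a + Cᵀ *ᵥ c) ⬝ᵥ S *ᵥ (a + Cᵀ *ᵥ c) + c ⬝ᵥ Q *ᵥ c =
        a ⬝ᵥ S *ᵥ a + 2 * (c ⬝ᵥ (C * S) *ᵥ a) + c ⬝ᵥ M *ᵥ c := by
      have : a ⬝ᵥ S *ᵥ (Cᵀ *ᵥ c) = c ⬝ᵥ (C * S) *ᵥ a := by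
        rw [← PosSemidef.symm hS, ← mulVec_dotProduct_comm, dotProduct_comm, mulVec_dotProduct_comm,
          transpose_transpose, PosSemidef.symm hS, mulVec_mulVec]
      rw [hM, add_mulVec, dotProduct_add c, mulVec_add, add_dotProduct, dotProduct_add,
        dotProduct_add, this, mulVec_dotProduct_comm, mulVec_dotProduct_comm, transpose_transpose,
        mulVec_mulVec, mulVec_mulVec, mulVec_mulVec, Matrix.mul_assoc]
      ring
    rw [e1]
    have e2 : c ⬝ᵥ M *ᵥ c = b ⬝ᵥ M *ᵥ b - b ⬝ᵥ (C * S) *ᵥ a - c ⬝ᵥ (C * S) *ᵥ a := by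
      have hMt : Mᵀ = M := by
        simp [hM, transpose_mul, PosSemidef.symm hS, PosSemidef.symm hQ, Matrix.mul_assoc]
      have : (Kᵀ *ᵥ a) ⬝ᵥ M *ᵥ b = b ⬝ᵥ (C * S) *ᵥ a := by
        rw [dotProduct_comm, mulVec_dotProduct_comm, hMt, mulVec_mulVec, hKt]
      have h3 : c ⬝ᵥ M *ᵥ c = c ⬝ᵥ M *ᵥ b - c ⬝ᵥ (C * S) *ᵥ a := by
        conv_lhs => rw [hc, mulVec_sub, mulVec_mulVec, hKt, dotProduct_sub, ← hc]
      rw [h3]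
      conv_lhs => rw [hc, sub_dotProduct, this, ← hc]
    have e3 : a ⬝ᵥ (S - K * C * S) *ᵥ a = a ⬝ᵥ S *ᵥ a - (Kᵀ *ᵥ a) ⬝ᵥ (C * S) *ᵥ a := by
      rw [sub_mulVec, dotProduct_sub, mulVec_dotProduct_comm, transpose_transpose, mulVec_mulVec,
        Matrix.mul_assoc]
    rw [e2, e3, hc, sub_dotProduct]
    push_cast
    ring
  have hpsd : (S - K * C * S).PosSemidef := by
    -- Joseph's form of the updated covariance
    have : S - K * C * S = (1 - K * C) * S * (1 - K * C)ᵀ + K * Q * Kᵀ := by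
      have h1 : K * (C * S * Cᵀ) * Kᵀ + K * Q * Kᵀ = K * (C * S) := by
        rw [← Matrix.add_mul, ← Matrix.mul_add, ← hM, Matrix.mul_assoc, hKt]
      have h2 : S * (Cᵀ * Kᵀ) = K * (C * S) := by
        rw [← Matrix.mul_assoc, ← hK, Matrix.mul_assoc, hKt]
      rw [transpose_sub, transpose_one, transpose_mul, Matrix.mul_sub, Matrix.mul_one,
        Matrix.sub_mul, Matrix.one_mul,
        Matrix.sub_mul, h2]
      have h3 : K * C * S * (Cᵀ * Kᵀ) = K * (C * S * Cᵀ) * Kᵀ := by simp only [Matrix.mul_assoc]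
      rw [h3, eq_sub_iff_add_eq.2 h1, Matrix.mul_assoc K C S]
      abel
    rw [this]
    refine Matrix.PosSemidef.add ?_ ?_
    · exact hS.mul_mul_conjTranspose_same (1 - K * C)
    · exact hQ.mul_mul_conjTranspose_same K
  have hξ : Measurable fun ω => C *ᵥ X ω + V ω := (measurable_const_mulVec C hX).add hV
  have hε : Measurable fun ω => X ω - K *ᵥ (C *ᵥ X ω + V ω) :=
    hX.sub (measurable_const_mulVec K hξ)
  refine ⟨hpsd, map_eq_gaussianVec hε hpsd fun a => ?_, indepFun_of_integral_cexp hε hξ key⟩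
  simpa using key a 0

end Gaussian

/-! ### Independence of triples -/

section Indep

variable {Ω : Type*} [MeasurableSpace Ω] {P : Measure Ω} [IsProbabilityMeasure P]
  {α β γ : Type*} [MeasurableSpace α] [MeasurableSpace β] [MeasurableSpace γ]
  {X : Ω → α} {Y : Ω → β} {Z : Ω → γ}

lemma indepFun_assoc (hX : Measurable X) (hY : Measurable Y) (hZ : Measurable Z)
    (h : IndepFun X Y P) (h' : IndepFun (fun ω => (X ω, Y ω)) Z P) :
    IndepFun X (fun ω => (Y ω, Z ω)) P := by
  have := Measure.isProbabilityMeasure_map (μ := P) hX.aemeasurable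
  have := Measure.isProbabilityMeasure_map (μ := P) hY.aemeasurable
  have := Measure.isProbabilityMeasure_map (μ := P) hZ.aemeasurable
  have hYZ : IndepFun Y Z P := h'.comp measurable_snd measurable_id
  rw [indepFun_iff_map_prod_eq_prod_map_map (by fun_prop) (by fun_prop)] at h h' hYZ ⊢
  rw [h] at h'
  rw [hYZ, ← Measure.prodAssoc_prod, ← h', Measure.map_map (by fun_prop) (by fun_prop)]
  rfl

lemma indepFun_prod_left (hX : Measurable X) (hY : Measurable Y) (hZ : Measurable Z)
    (h : IndepFun Y Z P) (h' : IndepFun X (fun ω => (Y ω, Z ω)) P) :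
    IndepFun (fun ω => (X ω, Y ω)) Z P := by
  have h1 : IndepFun Z (fun ω => (Y ω, X ω)) P :=
    indepFun_assoc hZ hY hX h.symm (h'.symm.comp measurable_swap measurable_id)
  exact h1.symm.comp measurable_swap measurable_id

end Indep

/-! ### The Kalman filter of the uncontrolled system -/

namespace Problem

variable {n m p M : ℕ} (S : Problem n m p M)

/-- The Kalman gain `Σ_{t|t-1} Cᵀ M_t⁻¹`. -/
noncomputable def kalmanGain (t : ℕ) : Matrix (Fin n) (Fin p) ℝ :=
  S.predCov t * S.Cᵀ * (S.innovCov t)⁻¹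

/-- The one-step prediction error of the Kalman filter, as a function of the initial state and of
the noise sequences. -/
noncomputable def predError (x : Vec n) (w : ℕ → Vec n) (v : ℕ → Vec p) : ℕ → Vec n
  | 0 => x - S.mean0
  | t + 1 => S.A *ᵥ (predError x w v t -
      S.kalmanGain t *ᵥ (S.C *ᵥ predError x w v t + v t)) + w t

variable {S}

lemma predError_congr {x : Vec n} {w w' : ℕ → Vec n} {v v' : ℕ → Vec p} {t : ℕ}
    (hw : ∀ s < t, w s = w' s) (hv : ∀ s < t, v s = v' s) :
    S.predError x w v t = S.predError x w' v' t := by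
  induction t with
  | zero => rfl
  | succ t ih =>
    rw [predError, predError, ih (fun s hs => hw s (by omega)) (fun s hs => hv s (by omega)),
      hw t (by omega), hv t (by omega)]

lemma measurable_predError {α : Type*} [MeasurableSpace α] {x : α → Vec n} {w : α → ℕ → Vec n}
    {v : α → ℕ → Vec p} (hx : Measurable x) (hw : Measurable w) (hv : Measurable v) (t : ℕ) :
    Measurable fun a => S.predError (x a) (w a) (v a) t := by
  induction t with
  | zero => exact hx.sub measurable_const
  | succ t ih =>
    exact (measurable_const_mulVec _ (ih.sub (measurable_const_mulVec _
      ((measurable_const_mulVec _ ih).add (by fun_prop))))).add (by fun_prop)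

end Problem

namespace Noise

variable {n m p M : ℕ} {S : Problem n m p M} {Ω : Type*} [MeasurableSpace Ω] {P : Measure Ω}
  (noise : Noise S P)

/-- The prediction error `X_t - E[X_t | Y₀, …, Y_{t-1}]`. -/
noncomputable def err (t : ℕ) (ω : Ω) : Vec n :=
  S.predError (noise.X0 ω) (fun s => noise.W s ω) (fun s => noise.V s ω) t

/-- The innovation of the uncontrolled system. -/
noncomputable def innov (t : ℕ) (ω : Ω) : Vec p := S.C *ᵥ noise.err t ω + noise.V t ω

/-- The estimation error `X_t - E[X_t | Y₀, …, Y_t]`. -/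
noncomputable def residual (t : ℕ) (ω : Ω) : Vec n :=
  noise.err t ω - S.kalmanGain t *ᵥ noise.innov t ω

/-- The innovations before time `t`, padded with zeros. -/
noncomputable def past (t : ℕ) (ω : Ω) : ℕ → Vec p := fun s => if s < t then noise.innov s ω else 0

lemma err_zero (ω : Ω) : noise.err 0 ω = noise.X0 ω - S.mean0 := rfl

lemma err_succ (t : ℕ) (ω : Ω) :
    noise.err (t + 1) ω = S.A *ᵥ noise.residual t ω + noise.W t ω := rfl

lemma measurable_err (t : ℕ) : Measurable (noise.err t) :=
  Problem.measurable_predError noise.measurable_X0 (measurable_pi_lambda _ noise.measurable_W)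
    (measurable_pi_lambda _ noise.measurable_V) t

lemma measurable_innov (t : ℕ) : Measurable (noise.innov t) :=
  (measurable_const_mulVec _ (noise.measurable_err t)).add (noise.measurable_V t)

lemma measurable_residual (t : ℕ) : Measurable (noise.residual t) :=
  (noise.measurable_err t).sub (measurable_const_mulVec _ (noise.measurable_innov t))

lemma measurable_past (t : ℕ) : Measurable (noise.past t) := by
  refine measurable_pi_lambda _ fun s => ?_
  unfold past
  split_ifs
  · exact noise.measurable_innov s
  · exact measurable_const

lemma past_succ (t : ℕ) (ω : Ω) :
    noise.past (t + 1) ω = Function.update (noise.past t ω) t (noise.innov t ω) := by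
  funext s
  rcases lt_trichotomy s t with h | h | h
  · simp [past, h, h.ne, Nat.lt_succ_of_lt h]
  · subst h; simp [past]
  · simp [past, h.ne', not_lt.2 h.le, show ¬ s < t + 1 by omega]

lemma past_apply_of_lt {s t : ℕ} (h : s < t) (ω : Ω) : noise.past t ω s = noise.innov s ω := by
  simp [past, h]

/-- The history `(past t, err t)` as a function of the primitive random variables. -/
noncomputable def historyOf (S : Problem n m p M) (t : ℕ) (x : Vec n) (w : ℕ → Vec n)
    (v : ℕ → Vec p) : (ℕ → Vec p) × Vec n :=
  (fun s => if s < t then S.C *ᵥ S.predError x w v s + v s else 0, S.predError x w v t)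

lemma measurable_historyOf {α : Type*} [MeasurableSpace α] {x : α → Vec n} {w : α → ℕ → Vec n}
    {v : α → ℕ → Vec p} (hx : Measurable x) (hw : Measurable w) (hv : Measurable v) (t : ℕ) :
    Measurable fun a => historyOf S t (x a) (w a) (v a) := by
  refine Measurable.prodMk (measurable_pi_lambda _ fun s => ?_)
    (Problem.measurable_predError hx hw hv t)
  split_ifs
  · exact (measurable_const_mulVec _ (Problem.measurable_predError hx hw hv s)).add (by fun_prop)
  · exact measurable_const

lemma historyOf_congr {t : ℕ} {x : Vec n} {w w' : ℕ → Vec n} {v v' : ℕ → Vec p}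
    (hw : ∀ s < t, w s = w' s) (hv : ∀ s < t, v s = v' s) :
    historyOf S t x w v = historyOf S t x w' v' := by
  unfold historyOf
  congr 1
  · funext s
    split_ifs with h
    · rw [Problem.predError_congr (fun r hr => hw r (hr.trans h)) (fun r hr => hv r (hr.trans h)),
        hv s h]
    · rfl
  · exact Problem.predError_congr hw hv

lemma history_eq (t : ℕ) (ω : Ω) : (noise.past t ω, noise.err t ω) =
    historyOf S t (noise.X0 ω) (fun s => noise.W s ω) (fun s => noise.V s ω) := rfl

/-- In an independent sequence, the values before time `t` are independent of the value at `t`. -/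
lemma indepFun_truncate {E : Type*} [MeasurableSpace E] [Zero E] {Z : ℕ → Ω → E}
    (hZ : ∀ t, Measurable (Z t)) (h : iIndepFun Z P) (t : ℕ) :
    IndepFun (fun ω => fun s => if s < t then Z s ω else 0) (Z t) P := by
  have h1 := h.indepFun_finset (Finset.range t) {t} (by simp) hZ
  have hf : Measurable fun (z : Finset.range t → E) (s : ℕ) =>
      if hs : s ∈ Finset.range t then z ⟨s, hs⟩ else 0 := by
    refine measurable_pi_lambda _ fun s => ?_
    split_ifs
    · fun_prop
    · exact measurable_const
  have h2 := h1.comp hf (measurable_pi_apply (⟨t, by simp⟩ : ({t} : Finset ℕ)))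
  refine IndepFun.congr h2 (.of_forall fun ω => ?_) (.of_forall fun ω => rfl)
  funext s
  simp [Finset.mem_range]

section

variable [IsProbabilityMeasure P]

lemma indepFun_history_V (t : ℕ) :
    IndepFun (fun ω => (noise.past t ω, noise.err t ω)) (noise.V t) P := by
  have mW : Measurable fun ω t => noise.W t ω := measurable_pi_lambda _ noise.measurable_W
  have mV : Measurable fun ω t => noise.V t ω := measurable_pi_lambda _ noise.measurable_V
  have mT : Measurable fun (z : ℕ → Vec p) (s : ℕ) => if s < t then z s else 0 :=
    measurable_pi_lambda _ fun s => by split_ifs <;> fun_prop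
  have mp := mT.comp mV
  have h1 := indepFun_truncate noise.measurable_V noise.indep_V t
  have h2 := indepFun_prod_left mW mp (noise.measurable_V t) h1
    (noise.indep_W_V.comp measurable_id (mT.prodMk (measurable_pi_apply t)))
  have h3 := indepFun_prod_left noise.measurable_X0 (mW.prodMk mp) (noise.measurable_V t) h2
    (noise.indep_X0.comp measurable_id
      ((measurable_fst.prodMk (mT.comp measurable_snd)).prodMk
        ((measurable_pi_apply t).comp measurable_snd)))
  have h4 := h3.comp (measurable_historyOf (S := S) measurable_fst
    (measurable_fst.comp measurable_snd) (measurable_snd.comp measurable_snd) t) measurable_id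
  refine IndepFun.congr h4 (.of_forall fun ω => ?_) (.of_forall fun ω => rfl)
  beta_reduce
  rw [history_eq]
  exact historyOf_congr (fun s _ => rfl) (fun s hs => by simp [hs])

lemma indepFun_history_W (t : ℕ) :
    IndepFun (fun ω => ((noise.past t ω, noise.err t ω), noise.V t ω)) (noise.W t) P := by
  have mW : Measurable fun ω t => noise.W t ω := measurable_pi_lambda _ noise.measurable_W
  have mV : Measurable fun ω t => noise.V t ω := measurable_pi_lambda _ noise.measurable_V
  have mT : Measurable fun (z : ℕ → Vec n) (s : ℕ) => if s < t then z s else 0 :=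
    measurable_pi_lambda _ fun s => by split_ifs <;> fun_prop
  have mp := mT.comp mW
  have h1 := indepFun_truncate noise.measurable_W noise.indep_W t
  have h2 := indepFun_prod_left mV mp (noise.measurable_W t) h1
    (noise.indep_W_V.symm.comp measurable_id (mT.prodMk (measurable_pi_apply t)))
  have h3 := indepFun_prod_left noise.measurable_X0 (mV.prodMk mp) (noise.measurable_W t) h2
    (noise.indep_X0.comp measurable_id
      ((measurable_snd.prodMk (mT.comp measurable_fst)).prodMk
        ((measurable_pi_apply t).comp measurable_fst)))
  have h4 := h3.comp ((measurable_historyOf (S := S) measurable_fst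
    (measurable_snd.comp measurable_snd) (measurable_fst.comp measurable_snd) t).prodMk
      ((measurable_pi_apply t).comp (measurable_fst.comp measurable_snd))) measurable_id
  refine IndepFun.congr h4 (.of_forall fun ω => ?_) (.of_forall fun ω => rfl)
  beta_reduce
  rw [history_eq]
  refine Prod.ext ?_ rfl
  exact historyOf_congr (fun s hs => by simp [hs]) (fun s _ => rfl)

lemma map_err_zero : P.map (noise.err 0) = gaussianVec 0 S.cov0 := by
  refine map_eq_gaussianVec (noise.measurable_err 0) S.cov0_psd fun a => ?_
  have hc : Continuous fun x : Vec n => Complex.exp ((a ⬝ᵥ x : ℝ) * Complex.I) := by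
    unfold dotProduct
    fun_prop
  have h := integral_cexp_gaussianVec S.mean0 S.cov0_psd a
  rw [← noise.law_X0, integral_map noise.measurable_X0.aemeasurable hc.aestronglyMeasurable] at h
  have e : ∀ ω, Complex.exp ((a ⬝ᵥ noise.err 0 ω : ℝ) * Complex.I) =
      Complex.exp ((a ⬝ᵥ noise.X0 ω : ℝ) * Complex.I) *
        Complex.exp (-((a ⬝ᵥ S.mean0 : ℝ) * Complex.I)) := fun ω => by
    rw [← Complex.exp_add, err_zero, dotProduct_sub]
    push_cast
    ring_nf
  simp only [e]
  rw [integral_mul_const, h, ← Complex.exp_add]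
  congr 1
  ring

lemma kalmanGain_mul {t : ℕ} (h : IsUnit (S.innovCov t)) :
    S.kalmanGain t * (S.C * S.predCov t * S.Cᵀ + S.covV) = S.predCov t * S.Cᵀ :=
  nonsing_inv_mul_cancel_right _ _ ((isUnit_iff_isUnit_det _).1 h)

/-- One step of the Kalman filter: if the prediction error is `N(0, Σ_{t|t-1})` and independent of
the past innovations, then the residual is independent of the innovations up to the present, the
present innovation is independent of the past ones, and both have the expected laws. -/
lemma kalman_step {t : ℕ} (hu : IsUnit (S.innovCov t)) (hS : (S.predCov t).PosSemidef)
    (hl : P.map (noise.err t) = gaussianVec 0 (S.predCov t))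
    (hi : IndepFun (noise.past t) (noise.err t) P) :
    IndepFun (noise.past t) (noise.innov t) P ∧
    P.map (noise.innov t) = gaussianVec 0 (S.innovCov t) ∧
    IndepFun (noise.past (t + 1)) (noise.residual t) P ∧
    (S.predCov (t + 1)).PosSemidef ∧
    P.map (noise.err (t + 1)) = gaussianVec 0 (S.predCov (t + 1)) ∧
    IndepFun (noise.past (t + 1)) (noise.err (t + 1)) P := by
  have mp := noise.measurable_past t
  have me := noise.measurable_err t
  have mV := noise.measurable_V t
  have mW := noise.measurable_W t
  have mξ := noise.measurable_innov t
  have mε := noise.measurable_residual t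
  -- the pair `(innov, residual)` is a function of `(err, V)`
  let f : Vec n × Vec p → Vec p × Vec n := fun z =>
    (S.C *ᵥ z.1 + z.2, z.1 - S.kalmanGain t *ᵥ (S.C *ᵥ z.1 + z.2))
  have mf1 : Measurable fun z : Vec n × Vec p => S.C *ᵥ z.1 + z.2 :=
    (measurable_const_mulVec _ measurable_fst).add measurable_snd
  have mf : Measurable f :=
    mf1.prodMk (measurable_fst.sub (measurable_const_mulVec _ mf1))
  have hpeV := noise.indepFun_history_V t
  have hpeVW := noise.indepFun_history_W t
  have heV : IndepFun (noise.err t) (noise.V t) P := hpeV.comp measurable_snd measurable_id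
  have hp_eV := indepFun_assoc mp me mV hi hpeV
  have hp_eVW : IndepFun (noise.past t)
      (fun ω => ((noise.err t ω, noise.V t ω), noise.W t ω)) P :=
    indepFun_assoc mp (me.prodMk mV) mW hp_eV
      (hpeVW.comp ((measurable_fst.comp measurable_fst).prodMk
        ((measurable_snd.comp measurable_fst).prodMk measurable_snd)) measurable_id)
  have heV_W : IndepFun (fun ω => (noise.err t ω, noise.V t ω)) (noise.W t) P :=
    hpeVW.comp ((measurable_snd.comp measurable_fst).prodMk measurable_snd) measurable_id
  obtain ⟨hS', lε, hεξ⟩ := kalman_update me mV heV hS S.covV_psd hl (noise.law_V t) S.C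
    (S.kalmanGain t) (kalmanGain_mul hu)
  have lξ : P.map (noise.innov t) = gaussianVec 0 (S.innovCov t) :=
    map_linear_add_eq_gaussianVec me mV heV hS S.covV_psd hl (noise.law_V t) S.C
  have hξε_W : IndepFun (fun ω => (noise.innov t ω, noise.residual t ω)) (noise.W t) P :=
    heV_W.comp mf measurable_id
  have hξ_εW := indepFun_assoc mξ mε mW hεξ.symm hξε_W
  have hp_ξεW : IndepFun (noise.past t)
      (fun ω => (noise.innov t ω, (noise.residual t ω, noise.W t ω))) P :=
    hp_eVW.comp measurable_id ((measurable_fst.comp (mf.comp measurable_fst)).prodMk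
      ((measurable_snd.comp (mf.comp measurable_fst)).prodMk measurable_snd))
  have hpξ_εW := indepFun_prod_left mp mξ (mε.prodMk mW) hξ_εW hp_ξεW
  have mu : Measurable fun z : (ℕ → Vec p) × Vec p => Function.update z.1 t z.2 :=
    measurable_pi_lambda _ fun s => by
      simp only [Function.update_apply]
      split_ifs <;> fun_prop
  have hp_εW : IndepFun (noise.past (t + 1)) (fun ω => (noise.residual t ω, noise.W t ω)) P := by
    refine (hpξ_εW.comp mu measurable_id).congr (.of_forall fun ω => ?_) (.of_forall fun ω => rfl)
    exact (noise.past_succ t ω).symm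
  have hε_W : IndepFun (noise.residual t) (noise.W t) P :=
    hξε_W.comp measurable_snd measurable_id
  refine ⟨hp_ξεW.comp measurable_id measurable_fst, lξ, hp_εW.comp measurable_id measurable_fst,
    ?_, map_linear_add_eq_gaussianVec mε mW hε_W hS' S.covW_psd lε (noise.law_W t) S.A,
    hp_εW.comp measurable_id ((measurable_const_mulVec S.A measurable_fst).add measurable_snd)⟩
  exact (by simpa using hS'.mul_mul_conjTranspose_same S.A :
    (S.A * (S.predCov t - S.kalmanGain t * S.C * S.predCov t) * S.Aᵀ).PosSemidef).add S.covW_psd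

/-- The prediction error of the Kalman filter is Gaussian with covariance `Σ_{t|t-1}`, and
independent of the innovations before time `t`. -/
lemma law_err (hM : ∀ t < S.T, IsUnit (S.innovCov t)) {t : ℕ} (ht : t ≤ S.T) :
    (S.predCov t).PosSemidef ∧ P.map (noise.err t) = gaussianVec 0 (S.predCov t) ∧
    IndepFun (noise.past t) (noise.err t) P := by
  induction t with
  | zero =>
    refine ⟨S.cov0_psd, noise.map_err_zero, ?_⟩
    have : noise.past 0 = fun _ => 0 := by funext ω s; simp [past]
    rw [this]
    exact indepFun_const_left _ _
  | succ t ih =>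
    obtain ⟨h1, h2, h3⟩ := ih (by omega)
    exact (noise.kalman_step (hM t (by omega)) h1 h2 h3).2.2.2

lemma indepFun_past_innov (hM : ∀ t < S.T, IsUnit (S.innovCov t)) {t : ℕ} (ht : t < S.T) :
    IndepFun (noise.past t) (noise.innov t) P :=
  let h := noise.law_err hM ht.le
  (noise.kalman_step (hM t ht) h.1 h.2.1 h.2.2).1

lemma law_innov (hM : ∀ t < S.T, IsUnit (S.innovCov t)) {t : ℕ} (ht : t < S.T) :
    P.map (noise.innov t) = gaussianVec 0 (S.innovCov t) :=
  let h := noise.law_err hM ht.le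
  (noise.kalman_step (hM t ht) h.1 h.2.1 h.2.2).2.1

lemma indepFun_past_residual (hM : ∀ t < S.T, IsUnit (S.innovCov t)) {t : ℕ} (ht : t < S.T) :
    IndepFun (noise.past (t + 1)) (noise.residual t) P :=
  let h := noise.law_err hM ht.le
  (noise.kalman_step (hM t ht) h.1 h.2.1 h.2.2).2.2.1

/-- The innovation at time `s` is independent of all the other innovations. -/
lemma indepFun_innov_update (hM : ∀ t < S.T, IsUnit (S.innovCov t)) {s t : ℕ} (hst : s < t)
    (ht : t ≤ S.T) :
    IndepFun (noise.innov s) (fun ω => Function.update (noise.past t ω) s 0) P := by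
  have mu : ∀ r, Measurable fun z : (ℕ → Vec p) × Vec p => Function.update z.1 r z.2 := fun r =>
    measurable_pi_lambda _ fun s => by
      simp only [Function.update_apply]
      split_ifs <;> fun_prop
  have mu0 : Measurable fun z : ℕ → Vec p => Function.update z s 0 :=
    (mu s).comp (measurable_id.prodMk measurable_const)
  induction t, hst using Nat.le_induction with
  | base =>
    refine (noise.indepFun_past_innov hM (t := s) (by omega)).symm.congr (.of_forall fun ω => rfl)
      (.of_forall fun ω => ?_)
    beta_reduce
    rw [past_succ, Function.update_idem, eq_comm, Function.update_eq_self_iff]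
    simp [past]
  | succ t hst ih =>
    have h1 := ih (by omega)
    have h2 : IndepFun (fun ω => (noise.innov s ω, Function.update (noise.past t ω) s 0))
        (noise.innov t) P := by
      refine ((noise.indepFun_past_innov hM (t := t) (by omega)).comp
        ((measurable_pi_apply s).prodMk mu0) measurable_id).congr (.of_forall fun ω => ?_)
        (.of_forall fun ω => rfl)
      simp [noise.past_apply_of_lt (show s < t from hst)]
    have h3 := indepFun_assoc (noise.measurable_innov s) (mu0.comp (noise.measurable_past t))
      (noise.measurable_innov t) h1 h2
    refine (h3.comp measurable_id (mu t)).congr (.of_forall fun ω => rfl) (.of_forall fun ω => ?_)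
    simp only [Function.comp_apply, past_succ]
    exact Function.update_comm (show t ≠ s by omega) _ _ _ |>.symm

end

end Noise

/-! ### The feedback loop as a function of the innovations -/

lemma Quantizer.measurable_point {p : ℕ} (q : Quantizer p) : Measurable q.point :=
  measurable_of_countable _

lemma Quantizer.measurable_quantize {p : ℕ} (q : Quantizer p) : Measurable q.quantize :=
  q.measurable_point.comp q.measurable_idx

namespace Problem

variable {n m p M : ℕ} (S : Problem n m p M)

/-- The selected index and the arriving data at time `t`, as a function of the sequence `z` of
innovations. They do not depend on the control strategy. -/
noncomputable def selObs (γΘ : SelectorPolicy p M) (z : ℕ → Vec p) (t : ℕ) : Fin M × Obs p M :=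
  let σ : Fin M := γΘ.act t (fun s : Fin t => (selObs γΘ z s).2, fun s : Fin t => (selObs γΘ z s).1)
  (σ, S.arrivals t (fun s => z s)
    (Fin.snoc (α := fun _ => Fin M) (fun s : Fin t => (selObs γΘ z s).1) σ))
termination_by t
decreasing_by all_goals exact s.2

/-- The index selected at time `t`, as a function of the innovations. -/
noncomputable def selOf (γΘ : SelectorPolicy p M) (z : ℕ → Vec p) (t : ℕ) : Fin M :=
  (S.selObs γΘ z t).1

/-- The data arriving at time `t`, as a function of the innovations. -/
noncomputable def obsOf (γΘ : SelectorPolicy p M) (z : ℕ → Vec p) (t : ℕ) : Obs p M :=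
  (S.selObs γΘ z t).2

/-- The control at time `t`, as a function of the innovations. -/
noncomputable def ctrlOf (γU : ControlPolicy m p M) (γΘ : SelectorPolicy p M) (z : ℕ → Vec p)
    (t : ℕ) : Vec m :=
  γU.act t (fun s => S.obsOf γΘ z s, fun s : Fin t => ctrlOf γU γΘ z s)
termination_by t
decreasing_by exact s.2

variable {S} {γU : ControlPolicy m p M} {γΘ : SelectorPolicy p M}

lemma selOf_eq (z : ℕ → Vec p) (t : ℕ) : S.selOf γΘ z t =
    γΘ.act t (fun s : Fin t => S.obsOf γΘ z s, fun s : Fin t => S.selOf γΘ z s) := by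
  rw [selOf, selObs]
  rfl

lemma snoc_apply_val {α : Type*} (f : ℕ → α) (t : ℕ) :
    (Fin.snoc (α := fun _ => α) (fun s : Fin t => f s) (f t) : Fin (t + 1) → α) =
      fun s : Fin (t + 1) => f s := by
  funext s
  refine Fin.lastCases ?_ (fun s => ?_) s
  · simp
  · simp

lemma obsOf_eq (z : ℕ → Vec p) (t : ℕ) : S.obsOf γΘ z t =
    S.arrivals t (fun s => z s) (fun s : Fin (t + 1) => S.selOf γΘ z s) := by
  have h : S.obsOf γΘ z t = S.arrivals t (fun s => z s)
      (Fin.snoc (α := fun _ => Fin M) (fun s : Fin t => S.selOf γΘ z s) (S.selOf γΘ z t)) := by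
    rw [obsOf, selObs, selOf_eq]
    rfl
  rw [h, snoc_apply_val]

lemma ctrlOf_eq (z : ℕ → Vec p) (t : ℕ) : S.ctrlOf γU γΘ z t =
    γU.act t (fun s => S.obsOf γΘ z s, fun s : Fin t => S.ctrlOf γU γΘ z s) := by
  rw [ctrlOf]

lemma obsOf_apply (z : ℕ → Vec p) (t : ℕ) (i : Fin M) : S.obsOf γΘ z t i =
    if S.delay i ≤ t ∧ S.selOf γΘ z (t - S.delay i) = i then
      (true, (S.quantizer i).quantize (z (t - S.delay i))) else (false, 0) := by
  rw [obsOf_eq]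
  rfl

/-- The data up to time `t` depend only on the quantized values of the innovations that have
arrived by then. -/
lemma selObs_congr {z z' : ℕ → Vec p} {t : ℕ}
    (h : ∀ r ≤ t, r + S.delay (S.selOf γΘ z r) ≤ t →
      (S.quantizer (S.selOf γΘ z r)).quantize (z r) =
        (S.quantizer (S.selOf γΘ z r)).quantize (z' r)) {r : ℕ} (hr : r ≤ t) :
    S.selOf γΘ z r = S.selOf γΘ z' r ∧ S.obsOf γΘ z r = S.obsOf γΘ z' r := by
  induction r using Nat.strong_induction_on with
  | _ r ih =>
    have hsel : ∀ k ≤ r, S.selOf γΘ z k = S.selOf γΘ z' k := by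
      intro k hk
      rcases hk.lt_or_eq with hk | rfl
      · exact (ih k hk (by omega)).1
      · rw [selOf_eq, selOf_eq]
        congr 2
        · funext s
          exact (ih s s.2 (by omega)).2
        · funext s
          exact (ih s s.2 (by omega)).1
    refine ⟨hsel r le_rfl, ?_⟩
    funext i
    rw [obsOf_apply, obsOf_apply, ← hsel _ (Nat.sub_le _ _)]
    split_ifs with hi
    · obtain ⟨h1, h2⟩ := hi
      have := h (r - S.delay i) (by omega) (by rw [h2]; omega)
      rw [h2] at this
      rw [this]
    · rfl

lemma selOf_congr {z z' : ℕ → Vec p} {t : ℕ} (h : ∀ r < t, z r = z' r) :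
    S.selOf γΘ z t = S.selOf γΘ z' t := by
  rw [selOf_eq, selOf_eq]
  have h1 : ∀ s < t, S.selOf γΘ z s = S.selOf γΘ z' s ∧ S.obsOf γΘ z s = S.obsOf γΘ z' s :=
    fun s hs => selObs_congr (t := s) (fun r hr _ => by rw [h r (by omega)]) le_rfl
  congr 2
  · funext s
    exact (h1 s s.2).2
  · funext s
    exact (h1 s s.2).1

lemma ctrlOf_congr_of_obsOf {z z' : ℕ → Vec p} {t : ℕ}
    (h : ∀ r ≤ t, S.obsOf γΘ z r = S.obsOf γΘ z' r) :
    S.ctrlOf γU γΘ z t = S.ctrlOf γU γΘ z' t := by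
  induction t using Nat.strong_induction_on with
  | _ t ih =>
    rw [ctrlOf_eq, ctrlOf_eq]
    congr 2
    · funext s
      exact h s (by omega)
    · funext s
      exact ih s s.2 (fun r hr => h r (by omega))

lemma ctrlOf_congr {z z' : ℕ → Vec p} {t : ℕ} (h : ∀ r ≤ t, z r = z' r) :
    S.ctrlOf γU γΘ z t = S.ctrlOf γU γΘ z' t :=
  ctrlOf_congr_of_obsOf fun r hr =>
    (selObs_congr (t := t) (fun k hk _ => by rw [h k hk]) hr).2

lemma measurable_selOf_obsOf (γΘ : SelectorPolicy p M) (t : ℕ) :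
    Measurable (fun z => S.selOf γΘ z t) ∧ Measurable (fun z => S.obsOf γΘ z t) := by
  induction t using Nat.strong_induction_on with
  | _ t ih =>
    have h1 : Measurable (fun z => S.selOf γΘ z t) := by
      simp only [selOf_eq (t := t)]
      exact (γΘ.measurable_act t).comp
        ((measurable_pi_lambda _ fun s : Fin t => (ih s s.2).2).prodMk
        (measurable_pi_lambda _ fun s : Fin t => (ih s s.2).1))
    refine ⟨h1, measurable_pi_lambda _ fun i => ?_⟩
    simp only [obsOf_apply]
    have h2 : Measurable fun z => S.selOf γΘ z (t - S.delay i) := by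
      rcases (Nat.sub_le t (S.delay i)).lt_or_eq with h | h
      · exact (ih _ h).1
      · rwa [h]
    refine Measurable.ite ?_ (measurable_const.prodMk
      ((S.quantizer i).measurable_quantize.comp (measurable_pi_apply _))) measurable_const
    exact (MeasurableSet.const _).inter (h2 (measurableSet_singleton i))

lemma measurable_selOf (γΘ : SelectorPolicy p M) (t : ℕ) :
    Measurable fun z => S.selOf γΘ z t := (measurable_selOf_obsOf γΘ t).1

lemma measurable_obsOf (γΘ : SelectorPolicy p M) (t : ℕ) :
    Measurable fun z => S.obsOf γΘ z t := (measurable_selOf_obsOf γΘ t).2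

lemma measurable_ctrlOf (γU : ControlPolicy m p M) (γΘ : SelectorPolicy p M) (t : ℕ) :
    Measurable fun z => S.ctrlOf γU γΘ z t := by
  induction t using Nat.strong_induction_on with
  | _ t ih =>
    simp only [ctrlOf_eq (t := t)]
    exact (γU.measurable_act t).comp
      ((measurable_pi_lambda _ fun s : Fin (t + 1) => measurable_obsOf γΘ s).prodMk
        (measurable_pi_lambda _ fun s : Fin t => ih s s.2))

lemma finite_range_obsOf (γΘ : SelectorPolicy p M) (t : ℕ) :
    (Set.range fun z => S.obsOf γΘ z t).Finite := by
  have h : ∀ i, (insert (false, 0) (Set.range fun j => (true, (S.quantizer i).point j))).Finite :=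
    fun i => (Set.finite_range _).insert _
  refine (Set.Finite.pi' h).subset ?_
  rintro _ ⟨z, rfl⟩ i
  simp only [obsOf_apply]
  split_ifs
  · exact Or.inr ⟨_, rfl⟩
  · exact Or.inl rfl

lemma finite_range_ctrlOf (γU : ControlPolicy m p M) (γΘ : SelectorPolicy p M) (t : ℕ) :
    (Set.range fun z => S.ctrlOf γU γΘ z t).Finite := by
  induction t using Nat.strong_induction_on with
  | _ t ih =>
    have h1 : {f : Fin (t + 1) → Obs p M | ∀ s : Fin (t + 1),
        f s ∈ Set.range fun z => S.obsOf γΘ z s}.Finite :=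
      Set.Finite.pi' fun s : Fin (t + 1) => finite_range_obsOf γΘ s
    have h2 : {f : Fin t → Vec m | ∀ s : Fin t,
        f s ∈ Set.range fun z => S.ctrlOf γU γΘ z s}.Finite :=
      Set.Finite.pi' fun s : Fin t => ih s s.2
    refine ((h1.prod h2).image (γU.act t)).subset ?_
    rintro _ ⟨z, rfl⟩
    simp only [ctrlOf_eq (t := t)]
    exact ⟨_, ⟨fun s => ⟨z, rfl⟩, fun s => ⟨z, rfl⟩⟩, rfl⟩

/-! ### Decoding, and the certainty-equivalent controller -/

variable (S)

/-- The conditional mean of the innovation at time `s` given the data up to time `t`: the centroid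
of its cell if the quantized innovation has arrived by then, and `0` otherwise. -/
noncomputable def estOf (γΘ : SelectorPolicy p M) (z : ℕ → Vec p) (s t : ℕ) : Vec p :=
  if s + S.delay (S.selOf γΘ z s) ≤ t then
    S.cellMean s (S.selOf γΘ z s) ((S.quantizer (S.selOf γΘ z s)).idx (z s)) else 0

/-- The conditional mean of the innovation at time `s`, read off from the data `O` received up to
time `t`. -/
noncomputable def decode (s t : ℕ) (O : ℕ → Obs p M) : Vec p :=
  ∑ i : Fin M, if s + S.delay i ≤ t ∧ (O (s + S.delay i) i).1 = true then
    ∑ j, if (O (s + S.delay i) i).2 = (S.quantizer i).point j then S.cellMean s i j else 0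
  else 0

variable {S}

lemma decode_obsOf (z : ℕ → Vec p) (s t : ℕ) :
    S.decode s t (S.obsOf γΘ z) = S.estOf γΘ z s t := by
  have h : ∀ i, S.obsOf γΘ z (s + S.delay i) i = if S.selOf γΘ z s = i then
      (true, (S.quantizer i).quantize (z s)) else (false, 0) := fun i => by
    rw [obsOf_apply]
    simp
  unfold decode
  simp only [h]
  rw [Finset.sum_eq_single (S.selOf γΘ z s)]
  · simp only [if_true, and_true, estOf]
    congr 1
    rw [Finset.sum_eq_single ((S.quantizer (S.selOf γΘ z s)).idx (z s))]
    · simp [Quantizer.quantize]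
    · intro j _ hj
      rw [if_neg]
      intro h'
      exact hj ((S.quantizer _).point_injective h').symm
    · simp
  · intro i _ hi
    simp [Ne.symm hi]
  · simp

lemma decode_congr {s t : ℕ} {O O' : ℕ → Obs p M} (h : ∀ r ≤ t, O r = O' r) :
    S.decode s t O = S.decode s t O' := by
  unfold decode
  refine Finset.sum_congr rfl fun i _ => ?_
  by_cases hi : s + S.delay i ≤ t
  · rw [h _ hi]
  · simp [hi]

lemma measurable_decode (s t : ℕ) : Measurable (S.decode s t) := by
  unfold decode
  refine Finset.measurable_sum _ fun i _ => ?_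
  have h : Measurable fun O : ℕ → Obs p M => O (s + S.delay i) i := by fun_prop
  refine Measurable.ite ?_ ?_ measurable_const
  · exact (MeasurableSet.const _).inter
      ((measurable_fst.comp h) (measurableSet_singleton true))
  · refine Finset.measurable_sum _ fun j _ => Measurable.ite ?_ measurable_const measurable_const
    exact (measurable_snd.comp h) (measurableSet_singleton _)

variable (S)

/-- The response of the state to the controls `u`, from the zero initial state. -/
def forced (u : ℕ → Vec m) : ℕ → Vec n
  | 0 => 0
  | t + 1 => S.A *ᵥ forced u t + S.B *ᵥ u t

variable {S}

lemma forced_congr {u u' : ℕ → Vec m} {t : ℕ} (h : ∀ s < t, u s = u' s) :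
    S.forced u t = S.forced u' t := by
  induction t with
  | zero => rfl
  | succ t ih => rw [forced, forced, ih fun s hs => h s (by omega), h t (by omega)]

lemma measurable_forced {α : Type*} [MeasurableSpace α] {u : ℕ → α → Vec m} {t : ℕ}
    (h : ∀ s < t, Measurable (u s)) : Measurable fun a => S.forced (fun s => u s a) t := by
  induction t with
  | zero => exact measurable_const
  | succ t ih =>
    exact (measurable_const_mulVec _ (ih fun s hs => h s (by omega))).add
      (measurable_const_mulVec _ (h t (by omega)))

variable (S)

/-- The conditional mean of the state at time `t` given the data `O` up to time `t` and the earlier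
controls `u`. -/
noncomputable def stateMean (t : ℕ) (O : ℕ → Obs p M) (u : ℕ → Vec m) : Vec n :=
  S.A ^ t *ᵥ S.mean0 + S.forced u t + ∑ s ∈ Finset.range (t + 1), S.Psi t s *ᵥ S.decode s t O

variable {S} in
lemma measurable_stateMean {α : Type*} [MeasurableSpace α] {t : ℕ} {O : α → ℕ → Obs p M}
    {u : ℕ → α → Vec m} (hO : Measurable O) (hu : ∀ s < t, Measurable (u s)) :
    Measurable fun a => S.stateMean t (O a) (fun s => u s a) := by
  have h : Measurable fun a => ∑ s ∈ Finset.range (t + 1), S.Psi t s *ᵥ S.decode s t (O a) :=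
    Finset.measurable_sum _ fun s _ => measurable_const_mulVec _ ((measurable_decode s t).comp hO)
  exact (measurable_const.add (measurable_forced hu)).add h

/-- The certainty-equivalent controller `U_t = -L_t E[X_t | data up to time t]`. It does not depend
on the selection strategy. -/
noncomputable def certainty : ControlPolicy m p M where
  act t h := -(S.gain t *ᵥ S.stateMean t
    (fun s => if hs : s < t + 1 then h.1 ⟨s, hs⟩ else fun _ => (false, 0))
    (fun s => if hs : s < t then h.2 ⟨s, hs⟩ else 0))
  measurable_act t := by
    have hO : Measurable fun (h : (Fin (t + 1) → Obs p M) × (Fin t → Vec m)) (s : ℕ) =>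
        if hs : s < t + 1 then h.1 ⟨s, hs⟩ else fun _ => (false, 0) :=
      measurable_pi_lambda _ fun s => by
        split_ifs
        · exact (measurable_pi_apply _).comp measurable_fst
        · exact measurable_const
    have hu : ∀ s < t, Measurable fun (h : (Fin (t + 1) → Obs p M) × (Fin t → Vec m)) =>
        if hs : s < t then h.2 ⟨s, hs⟩ else 0 := fun s hs => by
      simp only [hs, dif_pos]
      exact (measurable_pi_apply _).comp measurable_snd
    exact (measurable_const_mulVec (S.gain t) (measurable_stateMean hO hu)).neg

variable {S}

lemma ctrlOf_certainty (z : ℕ → Vec p) (t : ℕ) : S.ctrlOf S.certainty γΘ z t =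
    -(S.gain t *ᵥ (S.A ^ t *ᵥ S.mean0 + S.forced (S.ctrlOf S.certainty γΘ z) t +
      ∑ s ∈ Finset.range (t + 1), S.Psi t s *ᵥ S.estOf γΘ z s t)) := by
  rw [ctrlOf_eq]
  change -(S.gain t *ᵥ S.stateMean t
    (fun s => if _ : s < t + 1 then S.obsOf γΘ z s else fun _ => (false, 0))
    (fun s => if _ : s < t then S.ctrlOf S.certainty γΘ z s else 0)) = _
  rw [stateMean, forced_congr (u' := S.ctrlOf S.certainty γΘ z) (fun s hs => by simp [hs])]
  congr 3
  refine Finset.sum_congr rfl fun s _ => ?_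
  rw [← decode_obsOf, decode_congr fun r hr => ?_]
  simp [Nat.lt_succ_of_le hr]

end Problem

/-! ### Square integrability -/

section MemLp

variable {Ω : Type*} [MeasurableSpace Ω] {P : Measure Ω} {k l : ℕ}

lemma memLp_mulVec {q : ENNReal} (H : Matrix (Fin l) (Fin k) ℝ) {f : Ω → Vec k} (hf : MemLp f q P) :
    MemLp (fun ω => H *ᵥ f ω) q P :=
  (LinearMap.toContinuousLinearMap (Matrix.mulVecLin H)).comp_memLp' hf

lemma memLp_of_map_eq_gaussianVec {f : Ω → Vec k} (hf : Measurable f) {μ : Vec k}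
    {H : Matrix (Fin k) (Fin k) ℝ} (h : P.map f = gaussianVec μ H) : MemLp f 2 P := by
  have := (memLp_map_measure_iff (μ := P) (f := f) (g := id) (p := 2)
    aestronglyMeasurable_id hf.aemeasurable).1 (h ▸ IsGaussian.memLp_two_id)
  exact this

lemma memLp_of_finite_range [IsFiniteMeasure P] {E : Type*} [NormedAddCommGroup E]
    {q : ENNReal} {f : Ω → E} (hf : AEStronglyMeasurable f P) (h : (Set.range f).Finite) :
    MemLp f q P := by
  obtain ⟨C, hC⟩ := h.isBounded.exists_norm_le
  exact MemLp.of_bound hf C (.of_forall fun ω => hC _ ⟨ω, rfl⟩)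

end MemLp

namespace Noise

variable {n m p M : ℕ} {S : Problem n m p M} {Ω : Type*} [MeasurableSpace Ω] {P : Measure Ω}
  (noise : Noise S P)

lemma memLp_W (t : ℕ) : MemLp (noise.W t) 2 P :=
  memLp_of_map_eq_gaussianVec (noise.measurable_W t) (noise.law_W t)

lemma memLp_V (t : ℕ) : MemLp (noise.V t) 2 P :=
  memLp_of_map_eq_gaussianVec (noise.measurable_V t) (noise.law_V t)

variable [IsProbabilityMeasure P]

lemma memLp_err (t : ℕ) : MemLp (noise.err t) 2 P := by
  induction t with
  | zero =>
    exact (memLp_of_map_eq_gaussianVec noise.measurable_X0 noise.law_X0).sub (memLp_const _)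
  | succ t ih =>
    exact (memLp_mulVec _ (ih.sub (memLp_mulVec _ ((memLp_mulVec _ ih).add (noise.memLp_V t))))).add
      (noise.memLp_W t)

lemma memLp_innov (t : ℕ) : MemLp (noise.innov t) 2 P :=
  (memLp_mulVec _ (noise.memLp_err t)).add (noise.memLp_V t)

lemma memLp_residual (t : ℕ) : MemLp (noise.residual t) 2 P :=
  (noise.memLp_err t).sub (memLp_mulVec _ (noise.memLp_innov t))

end Noise

/-! ### The closed loop driven by the innovations -/

namespace Problem

variable {n m p M : ℕ} (S : Problem n m p M)

/-- The one-step prediction of the state at time `t` from the innovations `z` and controls `u`. -/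
noncomputable def predMean (z : ℕ → Vec p) (u : ℕ → Vec m) (t : ℕ) : Vec n :=
  S.A ^ t *ᵥ S.mean0 + S.forced u t + ∑ s ∈ Finset.range t, S.Psi t s *ᵥ z s

variable {S}

lemma Psi_self (t : ℕ) : S.Psi t t = S.kalmanGain t := by
  simp [Psi, kalmanGain]

lemma Psi_succ {s t : ℕ} (h : s ≤ t) : S.Psi (t + 1) s = S.A * S.Psi t s := by
  rw [Psi, Psi, Nat.sub_add_comm h, pow_succ']
  simp only [Matrix.mul_assoc]

lemma predMean_succ (z : ℕ → Vec p) (u : ℕ → Vec m) (t : ℕ) :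
    S.predMean z u (t + 1) =
      S.A *ᵥ (S.predMean z u t + S.kalmanGain t *ᵥ z t) + S.B *ᵥ u t := by
  have h : ∑ s ∈ Finset.range (t + 1), S.Psi (t + 1) s *ᵥ z s =
      S.A *ᵥ (∑ s ∈ Finset.range (t + 1), S.Psi t s *ᵥ z s) := by
    rw [Matrix.mulVec_sum]
    refine Finset.sum_congr rfl fun s hs => ?_
    rw [Psi_succ (Nat.lt_succ_iff.1 (Finset.mem_range.1 hs)), mulVec_mulVec]
  rw [predMean, h, Finset.sum_range_succ, Psi_self, predMean, forced, pow_succ', ← mulVec_mulVec]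
  simp only [mulVec_add]
  abel

lemma measurable_predMean {α : Type*} [MeasurableSpace α] {z : ℕ → α → Vec p} {u : ℕ → α → Vec m}
    {t : ℕ} (hz : ∀ s < t, Measurable (z s)) (hu : ∀ s < t, Measurable (u s)) :
    Measurable fun a => S.predMean (fun s => z s a) (fun s => u s a) t := by
  have h : Measurable fun a => ∑ s ∈ Finset.range t, S.Psi t s *ᵥ z s a :=
    Finset.measurable_sum _ fun s hs => measurable_const_mulVec _ (hz s (Finset.mem_range.1 hs))
  exact (measurable_const.add (measurable_forced hu)).add h

/-- The innovations are causal functions of the outputs and the controls. -/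
lemma measurable_whitened {α : Type*} [MeasurableSpace α] {y z : ℕ → α → Vec p}
    {u : ℕ → α → Vec m} {t : ℕ}
    (h : ∀ s < t, ∀ a, y s a = S.C *ᵥ S.predMean (fun r => z r a) (fun r => u r a) s + z s a)
    (hy : ∀ s < t, Measurable (y s)) (hu : ∀ s < t, Measurable (u s)) {s : ℕ} (hs : s < t) :
    Measurable (z s) := by
  induction s using Nat.strong_induction_on with
  | _ s ih =>
    have e : z s = fun a => y s a - S.C *ᵥ S.predMean (fun r => z r a) (fun r => u r a) s := by
      funext a
      rw [h s hs]
      abel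
    rw [e]
    exact (hy s hs).sub (measurable_const_mulVec _
      (measurable_predMean (fun r hr => ih r hr (by omega)) (fun r hr => hu r (by omega))))

lemma memLp_forced {Ω : Type*} [MeasurableSpace Ω] {P : Measure Ω}
    {u : ℕ → Ω → Vec m} (hu : ∀ s, MemLp (u s) 2 P) (t : ℕ) :
    MemLp (fun ω => S.forced (fun s => u s ω) t) 2 P := by
  induction t with
  | zero => exact MemLp.zero
  | succ t ih => exact (memLp_mulVec _ ih).add (memLp_mulVec _ (hu t))

lemma memLp_predMean {Ω : Type*} [MeasurableSpace Ω] {P : Measure Ω} [IsFiniteMeasure P]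
    {z : ℕ → Ω → Vec p} {u : ℕ → Ω → Vec m} (hz : ∀ s, MemLp (z s) 2 P)
    (hu : ∀ s, MemLp (u s) 2 P) (t : ℕ) :
    MemLp (fun ω => S.predMean (fun s => z s ω) (fun s => u s ω) t) 2 P := by
  have h : MemLp (fun ω => ∑ s ∈ Finset.range t, S.Psi t s *ᵥ z s ω) 2 P :=
    memLp_finsetSum _ fun s _ => memLp_mulVec _ (hz s)
  have hc : MemLp (fun _ : Ω => S.A ^ t *ᵥ S.mean0) 2 P := memLp_const _
  exact (hc.add (memLp_forced hu t)).add h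

section ClosedLoop

variable {Ω : Type*} [MeasurableSpace Ω] {P : Measure Ω} (noise : Noise S P)
  (γU : ControlPolicy m p M) (γΘ : SelectorPolicy p M)

local notation "Z" => S.closedLoop noise γU γΘ

local notation "ℱ" t:max => pastSigma (fun s : Fin t => closedLoop S noise γU γΘ s)

lemma closedLoop_X_zero : (Z 0).X = noise.X0 := by
  rw [closedLoop]
  rfl

lemma closedLoop_X_succ (t : ℕ) (ω : Ω) :
    (Z (t + 1)).X ω = S.A *ᵥ (Z t).X ω + S.B *ᵥ (Z t).U ω + noise.W t ω := by
  rw [closedLoop]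
  rfl

lemma closedLoop_Y (t : ℕ) (ω : Ω) : (Z t).Y ω = S.C *ᵥ (Z t).X ω + noise.V t ω := by
  rw [closedLoop]
  rfl

lemma closedLoop_ξ (t : ℕ) :
    (Z t).ξ = (Z t).Y - P[(Z t).Y | pastSigma (fun s : Fin t => Z s)] := by
  rw [closedLoop]
  rfl

lemma closedLoop_sel_O (t : ℕ) (ω : Ω) :
    (Z t).sel ω = S.selOf γΘ (fun s => (Z s).ξ ω) t ∧
      (Z t).O ω = S.obsOf γΘ (fun s => (Z s).ξ ω) t := by
  induction t using Nat.strong_induction_on with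
  | _ t ih =>
    have h1 : (Z t).sel ω =
        γΘ.act t (fun s : Fin t => (Z s).O ω, fun s : Fin t => (Z s).sel ω) := by
      rw [closedLoop]
      rfl
    have h2 : (Z t).sel ω = S.selOf γΘ (fun s => (Z s).ξ ω) t := by
      rw [h1, selOf_eq]
      congr 2
      · funext s
        exact (ih s s.2).2
      · funext s
        exact (ih s s.2).1
    have h3 : (Z t).O ω = S.arrivals t
        (Fin.snoc (α := fun _ => Vec p) (fun s : Fin t => (Z s).ξ ω) ((Z t).ξ ω))
        (Fin.snoc (α := fun _ => Fin M) (fun s : Fin t => (Z s).sel ω) ((Z t).sel ω)) := by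
      rw [closedLoop]
      rfl
    refine ⟨h2, ?_⟩
    rw [h3, obsOf_eq, snoc_apply_val (fun s => (Z s).ξ ω), snoc_apply_val (fun s => (Z s).sel ω)]
    congr 1
    funext s
    rcases (Nat.lt_succ_iff.1 s.2).lt_or_eq with hs | hs
    · exact (ih s hs).1
    · rw [hs]
      exact h2

lemma closedLoop_U (t : ℕ) (ω : Ω) :
    (Z t).U ω = S.ctrlOf γU γΘ (fun s => (Z s).ξ ω) t := by
  induction t using Nat.strong_induction_on with
  | _ t ih =>
    have h : (Z t).U ω = γU.act t
        (Fin.snoc (α := fun _ => Obs p M) (fun s : Fin t => (Z s).O ω) ((Z t).O ω),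
          fun s : Fin t => (Z s).U ω) := by
      rw [closedLoop]
      rfl
    rw [h, ctrlOf_eq, snoc_apply_val (fun s => (Z s).O ω)]
    congr 2
    · funext s
      exact (closedLoop_sel_O noise γU γΘ s ω).2
    · funext s
      exact ih s s.2

/-- The state is the prediction error plus the one-step prediction. -/
lemma closedLoop_X (t : ℕ) (ω : Ω) : (Z t).X ω = noise.err t ω +
    S.predMean (fun s => noise.innov s ω) (fun s => (Z s).U ω) t := by
  induction t with
  | zero =>
    rw [closedLoop_X_zero, Noise.err_zero]
    simp [predMean, forced]
  | succ t ih =>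
    rw [closedLoop_X_succ, ih, predMean_succ, Noise.err_succ, Noise.residual]
    simp only [mulVec_add, mulVec_sub]
    abel

lemma closedLoop_Y_eq (t : ℕ) (ω : Ω) : (Z t).Y ω =
    S.C *ᵥ S.predMean (fun s => noise.innov s ω) (fun s => (Z s).U ω) t + noise.innov t ω := by
  rw [closedLoop_Y, closedLoop_X, Noise.innov, mulVec_add]
  abel

lemma measurable_closedLoop (t : ℕ) :
    Measurable (Z t).Y ∧ Measurable (Z t).ξ ∧ Measurable (Z t).U := by
  induction t using Nat.strong_induction_on with
  | _ t ih =>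
    have hY : Measurable (Z t).Y := by
      rw [show (Z t).Y = _ from funext (closedLoop_Y_eq noise γU γΘ t)]
      exact (measurable_const_mulVec _ (measurable_predMean (fun s _ => noise.measurable_innov s)
        (fun s hs => (ih s hs).2.2))).add (noise.measurable_innov t)
    have hle : pastSigma (fun s : Fin t => Z s) ≤ ‹MeasurableSpace Ω› :=
      iSup_le fun s => sup_le (ih s s.2).1.comap_le (ih s s.2).2.2.comap_le
    have hξ : Measurable (Z t).ξ := by
      rw [closedLoop_ξ]
      exact hY.sub (stronglyMeasurable_condExp.mono hle).measurable
    refine ⟨hY, hξ, ?_⟩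
    have e : (Z t).U = fun ω => S.ctrlOf γU γΘ (fun s => if s ≤ t then (Z s).ξ ω else 0) t := by
      funext ω
      rw [closedLoop_U]
      exact ctrlOf_congr fun r hr => by simp [hr]
    rw [e]
    refine (measurable_ctrlOf γU γΘ t).comp (measurable_pi_lambda _ fun s => ?_)
    rcases lt_trichotomy s t with h | h | h
    · simpa [h.le] using (ih s h).2.1
    · subst h
      simpa using hξ
    · simp [not_le.2 h]

lemma pastSigma_le (t : ℕ) : pastSigma (fun s : Fin t => Z s) ≤ ‹MeasurableSpace Ω› :=
  iSup_le fun s => sup_le (measurable_closedLoop noise γU γΘ s).1.comap_le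
    (measurable_closedLoop noise γU γΘ s).2.2.comap_le

lemma memLp_U [IsFiniteMeasure P] (t : ℕ) : MemLp (Z t).U 2 P := by
  refine memLp_of_finite_range
    (measurable_closedLoop noise γU γΘ t).2.2.aestronglyMeasurable ?_
  refine (finite_range_ctrlOf (S := S) γU γΘ t).subset ?_
  rintro _ ⟨ω, rfl⟩
  exact ⟨_, (closedLoop_U noise γU γΘ t ω).symm⟩

/-- If the earlier innovations of the closed loop agree with those of the Kalman filter, then the
present innovation of the Kalman filter is independent of the earlier outputs and controls. -/
lemma indep_innov_pastSigma [IsProbabilityMeasure P] (hM : ∀ t < S.T, IsUnit (S.innovCov t)) {t : ℕ}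
    (ht : t < S.T) (ih : ∀ s < t, (Z s).ξ =ᵐ[P] noise.innov s) :
    Indep (MeasurableSpace.comap (noise.innov t) inferInstance)
      (pastSigma (fun s : Fin t => Z s)) P := by
  let h : Ω → Fin t → Vec p × Vec m := fun ω s => ((Z s).Y ω, (Z s).U ω)
  let Φ : (ℕ → Vec p) → Fin t → Vec p × Vec m := fun z s =>
    (S.C *ᵥ S.predMean z (S.ctrlOf γU γΘ z) s + z s, S.ctrlOf γU γΘ z s)
  have mΦ : Measurable Φ := measurable_pi_lambda _ fun s =>
    ((measurable_const_mulVec _ (measurable_predMean (fun r _ => measurable_pi_apply r)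
      (fun r _ => measurable_ctrlOf γU γΘ r))).add (measurable_pi_apply _)).prodMk
      (measurable_ctrlOf γU γΘ s)
  have hh : (fun ω => Φ (noise.past t ω)) =ᵐ[P] h := by
    have hall : ∀ᵐ ω ∂P, ∀ s < t, (Z s).ξ ω = noise.innov s ω :=
      ae_all_iff.2 fun s => by
        by_cases hs : s < t
        · filter_upwards [ih s hs] with ω hω _ using hω
        · exact .of_forall fun ω hs' => absurd hs' hs
    filter_upwards [hall] with ω hω
    have hU : ∀ s < t, S.ctrlOf γU γΘ (noise.past t ω) s = (Z s).U ω := fun s hs => by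
      rw [closedLoop_U]
      refine ctrlOf_congr fun r hr => ?_
      rw [noise.past_apply_of_lt (by omega), hω r (by omega)]
    funext s
    refine Prod.ext ?_ (hU s s.2)
    simp only [Φ, h]
    rw [closedLoop_Y_eq, noise.past_apply_of_lt s.2]
    congr 2
    unfold predMean
    congr 1
    · congr 1
      exact forced_congr fun r hr => hU r (by omega)
    · refine Finset.sum_congr rfl fun r hr => ?_
      have := Finset.mem_range.1 hr
      rw [noise.past_apply_of_lt (by omega)]
  have hi : IndepFun (noise.innov t) h P :=
    ((noise.indepFun_past_innov hM ht).symm.comp measurable_id mΦ).congr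
      (.of_forall fun _ => rfl) hh
  refine indep_of_indep_of_le_right hi (iSup_le fun s => sup_le ?_ ?_)
  · have : (Z s).Y = (fun f : Fin t → Vec p × Vec m => (f s).1) ∘ h := rfl
    rw [this, ← MeasurableSpace.comap_comp]
    exact MeasurableSpace.comap_mono (measurable_fst.comp (measurable_pi_apply s)).comap_le
  · have : (Z s).U = (fun f : Fin t → Vec p × Vec m => (f s).2) ∘ h := rfl
    rw [this, ← MeasurableSpace.comap_comp]
    exact MeasurableSpace.comap_mono (measurable_snd.comp (measurable_pi_apply s)).comap_le

lemma integral_innov (hM : ∀ t < S.T, IsUnit (S.innovCov t)) [IsProbabilityMeasure P] {t : ℕ}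
    (ht : t < S.T) : ∫ ω, noise.innov t ω ∂P = 0 := by
  rw [← integral_gaussianVec 0 (S.innovCov t), ← noise.law_innov hM ht,
    integral_map (noise.measurable_innov t).aemeasurable (by fun_prop)]

/-- The innovations of the closed loop are those of the Kalman filter, whatever the strategies. -/
lemma closedLoop_ξ_ae_eq [IsProbabilityMeasure P] (hM : ∀ t < S.T, IsUnit (S.innovCov t)) {t : ℕ}
    (ht : t < S.T) : (Z t).ξ =ᵐ[P] noise.innov t := by
  induction t using Nat.strong_induction_on with
  | _ t ih =>
    have hle := pastSigma_le noise γU γΘ t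
    have hind := indep_innov_pastSigma noise γU γΘ hM ht fun s hs => ih s hs (by omega)
    let g : Ω → Vec p := fun ω =>
      S.C *ᵥ S.predMean (fun s => noise.innov s ω) (fun s => (Z s).U ω) t
    have hY : (Z t).Y = g + noise.innov t := funext (closedLoop_Y_eq noise γU γΘ t)
    have mY : ∀ s < t, Measurable[ℱ t] (Z s).Y := fun s hs =>
      Measurable.of_comap_le
      (le_sup_left.trans (le_iSup (fun s : Fin t => MeasurableSpace.comap (Z s).Y inferInstance ⊔
        MeasurableSpace.comap (Z s).U inferInstance) ⟨s, hs⟩))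
    have mU : ∀ s < t, Measurable[ℱ t] (Z s).U := fun s hs =>
      Measurable.of_comap_le
      (le_sup_right.trans (le_iSup (fun s : Fin t => MeasurableSpace.comap (Z s).Y inferInstance ⊔
        MeasurableSpace.comap (Z s).U inferInstance) ⟨s, hs⟩))
    have mι : ∀ s < t, Measurable[ℱ t] (noise.innov s) :=
      fun s hs => @measurable_whitened n m p M S Ω (ℱ t) (fun s => (Z s).Y) noise.innov
        (fun s => (Z s).U) t
        (fun s _ ω => closedLoop_Y_eq noise γU γΘ s ω) mY mU s hs
    have mg : Measurable[ℱ t] g := @measurable_const_mulVec Ω (ℱ t) _ _ S.C _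
      (@measurable_predMean n m p M S Ω (ℱ t) _ _ t mι mU)
    have ig : Integrable g P := (memLp_mulVec _ (memLp_predMean noise.memLp_innov
      (fun s => memLp_U noise γU γΘ s) t)).integrable one_le_two
    have iι : Integrable (noise.innov t) P := (noise.memLp_innov t).integrable one_le_two
    have h1 : P[g + noise.innov t | ℱ t] =ᵐ[P] P[g | ℱ t] + P[noise.innov t | ℱ t] :=
      condExp_add ig iι (ℱ t)
    have h2 : P[g | ℱ t] = g := condExp_of_stronglyMeasurable hle mg.stronglyMeasurable ig
    have h3 : P[noise.innov t | ℱ t] =ᵐ[P] fun _ => ∫ ω, noise.innov t ω ∂P :=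
      condExp_indep_eq (noise.measurable_innov t).comap_le hle
        (comap_measurable _).stronglyMeasurable hind
    rw [closedLoop_ξ, hY]
    filter_upwards [h1, h3] with ω hω1 hω3
    rw [Pi.sub_apply, hω1, Pi.add_apply, Pi.add_apply, hω3, h2, integral_innov noise hM ht]
    simp

end ClosedLoop

end Problem

/-! ### Completing the squares -/

section Algebra

variable {k l : ℕ}

lemma mulVec_dotProduct_mulVec (H : Matrix (Fin l) (Fin k) ℝ) (x : Vec k)
    (G : Matrix (Fin l) (Fin l) ℝ)
    {j : ℕ} (K : Matrix (Fin l) (Fin j) ℝ) (y : Vec j) :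
    H *ᵥ x ⬝ᵥ G *ᵥ K *ᵥ y = x ⬝ᵥ (Hᵀ * G * K) *ᵥ y := by
  rw [mulVec_dotProduct_comm, mulVec_mulVec, mulVec_mulVec, Matrix.mul_assoc]

lemma dotProduct_mulVec_comm {G : Matrix (Fin k) (Fin k) ℝ} (hG : Gᵀ = G) (x y : Vec k) :
    x ⬝ᵥ G *ᵥ y = y ⬝ᵥ G *ᵥ x := by
  rw [dotProduct_comm, mulVec_dotProduct_comm, hG]

lemma quadForm_add {G : Matrix (Fin k) (Fin k) ℝ} (hG : Gᵀ = G) (x y : Vec k) :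
    (x + y) ⬝ᵥ G *ᵥ (x + y) = x ⬝ᵥ G *ᵥ x + 2 * (y ⬝ᵥ G *ᵥ x) + y ⬝ᵥ G *ᵥ y := by
  rw [mulVec_add, add_dotProduct, dotProduct_add, dotProduct_add, dotProduct_mulVec_comm hG x y]
  ring

end Algebra

namespace Problem

variable {n m p M : ℕ} (S : Problem n m p M)

/-- The weight `R + Bᵀ P B` of the control deviations, for the cost-to-go matrix `P`. -/
def ctrlWeight (H : Matrix (Fin n) (Fin n) ℝ) : Matrix (Fin m) (Fin m) ℝ := S.R + S.Bᵀ * H * S.B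

variable {S}

lemma ctrlWeight_posDef {H : Matrix (Fin n) (Fin n) ℝ} (hH : H.PosSemidef) :
    (S.ctrlWeight H).PosDef :=
  S.R_pd.add_posSemidef (by simpa using hH.conjTranspose_mul_mul_same S.B)

lemma ctrlWeight_mul_gainOf {H : Matrix (Fin n) (Fin n) ℝ} (hH : H.PosSemidef) :
    S.ctrlWeight H * S.gainOf H = S.Bᵀ * H * S.A := by
  have h := (isUnit_iff_isUnit_det _).1 (ctrlWeight_posDef (S := S) hH).isUnit
  unfold gainOf
  rw [Matrix.mul_assoc, Matrix.mul_assoc, ← ctrlWeight, mul_nonsing_inv_cancel_left _ _ h,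
    Matrix.mul_assoc]

/-- One step of dynamic programming without noise. -/
lemma complete_square {H : Matrix (Fin n) (Fin n) ℝ} (hH : H.PosSemidef) (x : Vec n) (u : Vec m) :
    x ⬝ᵥ S.Q1 *ᵥ x + u ⬝ᵥ S.R *ᵥ u + (S.A *ᵥ x + S.B *ᵥ u) ⬝ᵥ H *ᵥ (S.A *ᵥ x + S.B *ᵥ u) =
      x ⬝ᵥ (S.Q1 + S.Aᵀ * H * S.A - (S.gainOf H)ᵀ * S.ctrlWeight H * S.gainOf H) *ᵥ x +
        (u + S.gainOf H *ᵥ x) ⬝ᵥ S.ctrlWeight H *ᵥ (u + S.gainOf H *ᵥ x) := by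
  have hG := PosSemidef.symm (ctrlWeight_posDef (S := S) hH).posSemidef
  have hc : u ⬝ᵥ (S.Bᵀ * H * S.A) *ᵥ x = S.gainOf H *ᵥ x ⬝ᵥ S.ctrlWeight H *ᵥ u := by
    rw [dotProduct_mulVec_comm hG, mulVec_mulVec, ctrlWeight_mul_gainOf hH]
  have hw : u ⬝ᵥ S.ctrlWeight H *ᵥ u = u ⬝ᵥ S.R *ᵥ u + u ⬝ᵥ (S.Bᵀ * H * S.B) *ᵥ u := by
    rw [ctrlWeight, add_mulVec, dotProduct_add]
  rw [quadForm_add hG, quadForm_add (PosSemidef.symm hH), sub_mulVec, add_mulVec, dotProduct_sub,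
    dotProduct_add, mulVec_dotProduct_mulVec, mulVec_dotProduct_mulVec, mulVec_dotProduct_mulVec,
    mulVec_dotProduct_mulVec, hc, hw]
  ring

lemma riccati_posSemidef (s : ℕ) : (S.riccati s).PosSemidef := by
  induction s with
  | zero => exact S.Q2_psd
  | succ s ih =>
    refine Matrix.PosSemidef.of_dotProduct_mulVec_nonneg ?_ fun x => ?_
    · have hG := PosSemidef.symm (ctrlWeight_posDef (S := S) ih).posSemidef
      change (_)ᴴ = _
      rw [conjTranspose_eq_transpose_of_trivial, riccati, ← ctrlWeight]
      simp only [transpose_sub, transpose_add, transpose_mul, transpose_transpose,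
        PosSemidef.symm S.Q1_psd, PosSemidef.symm ih, hG, Matrix.mul_assoc]
    · have h := complete_square (S := S) ih x (-(S.gainOf (S.riccati s) *ᵥ x))
      rw [neg_add_cancel, zero_dotProduct, add_zero] at h
      rw [star_trivial, riccati, ← ctrlWeight, ← h]
      have h1 := PosSemidef.nonneg S.Q1_psd x
      have h2 := PosSemidef.nonneg S.R_pd.posSemidef (-(S.gainOf (S.riccati s) *ᵥ x))
      have h3 := PosSemidef.nonneg ih (S.A *ᵥ x + S.B *ᵥ -(S.gainOf (S.riccati s) *ᵥ x))
      positivity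

lemma costToGo_posSemidef (k : ℕ) : (S.costToGo k).PosSemidef := riccati_posSemidef _

variable (S) in
/-- The weight `R + Bᵀ P_{t+1} B` of the deviation of `U_t` from `-L_t X_t`. -/
noncomputable def stageWeight (t : ℕ) : Matrix (Fin m) (Fin m) ℝ :=
  S.ctrlWeight (S.costToGo (t + 1))

lemma stageWeight_posDef (t : ℕ) : (S.stageWeight t).PosDef :=
  ctrlWeight_posDef (costToGo_posSemidef _)

lemma stageWeight_symm (t : ℕ) : (S.stageWeight t)ᵀ = S.stageWeight t :=
  PosSemidef.symm (stageWeight_posDef t).posSemidef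

lemma weightN_eq (t : ℕ) : S.weightN t = (S.gain t)ᵀ * S.stageWeight t * S.gain t := rfl

lemma complete_square_stage {t : ℕ} (ht : t < S.T) (x : Vec n) (u : Vec m) :
    x ⬝ᵥ S.Q1 *ᵥ x + u ⬝ᵥ S.R *ᵥ u +
      (S.A *ᵥ x + S.B *ᵥ u) ⬝ᵥ S.costToGo (t + 1) *ᵥ (S.A *ᵥ x + S.B *ᵥ u) =
      x ⬝ᵥ S.costToGo t *ᵥ x +
        (u + S.gain t *ᵥ x) ⬝ᵥ S.stageWeight t *ᵥ (u + S.gain t *ᵥ x) := by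
  have h := complete_square (S := S) (costToGo_posSemidef (S := S) (t + 1)) x u
  have e : S.costToGo t = S.Q1 + S.Aᵀ * S.costToGo (t + 1) * S.A -
      (S.gainOf (S.costToGo (t + 1)))ᵀ * S.ctrlWeight (S.costToGo (t + 1)) *
        S.gainOf (S.costToGo (t + 1)) := by
    conv_lhs => rw [costToGo, show S.T - t = S.T - (t + 1) + 1 by omega, riccati]
    rfl
  rw [h, ← e]
  rfl

/-- The cost along a trajectory, in terms of the deviations of the controls from `-L_t x_t`. -/
lemma sum_stage_cost {x : ℕ → Vec n} {u : ℕ → Vec m} {w : ℕ → Vec n}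
    (hx : ∀ t, x (t + 1) = S.A *ᵥ x t + S.B *ᵥ u t + w t) :
    ∑ t ∈ Finset.range S.T, (x t ⬝ᵥ S.Q1 *ᵥ x t + u t ⬝ᵥ S.R *ᵥ u t) +
        x S.T ⬝ᵥ S.Q2 *ᵥ x S.T =
      x 0 ⬝ᵥ S.costToGo 0 *ᵥ x 0 + ∑ t ∈ Finset.range S.T,
        ((u t + S.gain t *ᵥ x t) ⬝ᵥ S.stageWeight t *ᵥ (u t + S.gain t *ᵥ x t) +
          2 * (w t ⬝ᵥ S.costToGo (t + 1) *ᵥ (S.A *ᵥ x t + S.B *ᵥ u t)) +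
          w t ⬝ᵥ S.costToGo (t + 1) *ᵥ w t) := by
  have h : ∀ k ≤ S.T, ∑ t ∈ Finset.range k, (x t ⬝ᵥ S.Q1 *ᵥ x t + u t ⬝ᵥ S.R *ᵥ u t) +
        x k ⬝ᵥ S.costToGo k *ᵥ x k =
      x 0 ⬝ᵥ S.costToGo 0 *ᵥ x 0 + ∑ t ∈ Finset.range k,
        ((u t + S.gain t *ᵥ x t) ⬝ᵥ S.stageWeight t *ᵥ (u t + S.gain t *ᵥ x t) +
          2 * (w t ⬝ᵥ S.costToGo (t + 1) *ᵥ (S.A *ᵥ x t + S.B *ᵥ u t)) +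
          w t ⬝ᵥ S.costToGo (t + 1) *ᵥ w t) := by
    intro k hk
    induction k with
    | zero => simp
    | succ k ih =>
      have h1 := ih (by omega)
      have h2 := complete_square_stage (S := S) (t := k) (by omega) (x k) (u k)
      have h3 := quadForm_add (PosSemidef.symm (costToGo_posSemidef (S := S) (k + 1)))
        (S.A *ᵥ x k + S.B *ᵥ u k) (w k)
      rw [Finset.sum_range_succ, Finset.sum_range_succ, hx k, h3]
      linarith
  have := h S.T le_rfl
  rwa [show S.costToGo S.T = S.Q2 by simp [costToGo, riccati]] at this

end Problem

/-! ### Expectations of products of random vectors -/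

section Integral

variable {Ω : Type*} [MeasurableSpace Ω] {P : Measure Ω} {k l : ℕ}

lemma memLp_apply {q : ENNReal} {f : Ω → Vec k} (hf : MemLp f q P) (i : Fin k) :
    MemLp (fun ω => f ω i) q P :=
  (ContinuousLinearMap.proj (R := ℝ) (φ := fun _ : Fin k => ℝ) i).comp_memLp' hf

lemma integrable_dotProduct {f g : Ω → Vec k} (hf : MemLp f 2 P) (hg : MemLp g 2 P) :
    Integrable (fun ω => f ω ⬝ᵥ g ω) P := by
  unfold dotProduct
  exact integrable_finsetSum _ fun i _ => (memLp_apply hf i).integrable_mul (memLp_apply hg i)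

lemma integral_apply [IsFiniteMeasure P] {f : Ω → Vec k} (hf : MemLp f 2 P) (i : Fin k) :
    ∫ ω, f ω i ∂P = (∫ ω, f ω ∂P) i :=
  (ContinuousLinearMap.proj (R := ℝ) (φ := fun _ : Fin k => ℝ) i).integral_comp_comm
    (hf.integrable one_le_two)

lemma integral_dotProduct_eq_zero [IsFiniteMeasure P] {f g : Ω → Vec k} (hf : MemLp f 2 P)
    (hg : MemLp g 2 P) (h : IndepFun f g P) (h0 : ∫ ω, g ω ∂P = 0) :
    ∫ ω, f ω ⬝ᵥ g ω ∂P = 0 := by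
  unfold dotProduct
  have hint : ∀ i, Integrable (fun ω => f ω i * g ω i) P := fun i =>
    (memLp_apply hf i).integrable_mul (memLp_apply hg i)
  rw [integral_finsetSum _ fun i _ => hint i]
  refine Finset.sum_eq_zero fun i _ => ?_
  have hi : IndepFun (fun ω => f ω i) (fun ω => g ω i) P :=
    h.comp (measurable_pi_apply i) (measurable_pi_apply i)
  rw [hi.integral_fun_mul_eq_mul_integral (memLp_apply hf i).1 (memLp_apply hg i).1,
    integral_apply hg, h0]
  simp

end Integral

/-! ### The cost in terms of the innovations -/

namespace Problem

variable {n m p M : ℕ} (S : Problem n m p M)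

/-- The deviation of the control at time `t` from `-L_t E[X_t | Y₀, …, Y_t]`, as a function of the
innovations. -/
noncomputable def ctrlDev (γU : ControlPolicy m p M) (γΘ : SelectorPolicy p M) (z : ℕ → Vec p)
    (t : ℕ) : Vec m :=
  S.ctrlOf γU γΘ z t + S.gain t *ᵥ (S.A ^ t *ᵥ S.mean0 + S.forced (S.ctrlOf γU γΘ z) t +
    ∑ s ∈ Finset.range (t + 1), S.Psi t s *ᵥ z s)

variable {S} {γU : ControlPolicy m p M} {γΘ : SelectorPolicy p M}

lemma measurable_ctrlDev (γU : ControlPolicy m p M) (γΘ : SelectorPolicy p M) (t : ℕ) :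
    Measurable fun z => S.ctrlDev γU γΘ z t := by
  have h : Measurable fun z : ℕ → Vec p => ∑ s ∈ Finset.range (t + 1), S.Psi t s *ᵥ z s :=
    Finset.measurable_sum _ fun s _ => measurable_const_mulVec _ (measurable_pi_apply s)
  exact (measurable_ctrlOf γU γΘ t).add (measurable_const_mulVec _ ((measurable_const.add
    (measurable_forced (u := fun s z => S.ctrlOf γU γΘ z s)
      fun s _ => measurable_ctrlOf γU γΘ s)).add h))

lemma ctrlDev_congr {z z' : ℕ → Vec p} {t : ℕ} (h : ∀ r ≤ t, z r = z' r) :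
    S.ctrlDev γU γΘ z t = S.ctrlDev γU γΘ z' t := by
  unfold ctrlDev
  rw [ctrlOf_congr h, forced_congr fun s hs => ctrlOf_congr fun r hr => h r (by omega)]
  congr 3
  exact Finset.sum_congr rfl fun s hs => by rw [h s (Nat.lt_succ_iff.1 (Finset.mem_range.1 hs))]

section ClosedLoop

variable {Ω : Type*} [MeasurableSpace Ω] {P : Measure Ω} (noise : Noise S P)
  (γU : ControlPolicy m p M) (γΘ : SelectorPolicy p M)

local notation "Z" => S.closedLoop noise γU γΘ

lemma memLp_X [IsProbabilityMeasure P] (t : ℕ) : MemLp (Z t).X 2 P := by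
  rw [show (Z t).X = _ from funext (closedLoop_X noise γU γΘ t)]
  exact (noise.memLp_err t).add (memLp_predMean noise.memLp_innov (memLp_U noise γU γΘ) t)

lemma memLp_ctrlOf [IsFiniteMeasure P] (t k : ℕ) :
    MemLp (fun ω => S.ctrlOf γU γΘ (noise.past k ω) t) 2 P := by
  refine memLp_of_finite_range
    ((measurable_ctrlOf γU γΘ t).comp (noise.measurable_past k)).aestronglyMeasurable ?_
  refine (finite_range_ctrlOf (S := S) γU γΘ t).subset ?_
  rintro _ ⟨ω, rfl⟩
  exact ⟨_, rfl⟩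

lemma memLp_past [IsProbabilityMeasure P] (s k : ℕ) :
    MemLp (fun ω => noise.past k ω s) 2 P := by
  unfold Noise.past
  split_ifs
  · exact noise.memLp_innov s
  · exact MemLp.zero

lemma memLp_ctrlDev [IsProbabilityMeasure P] (t k : ℕ) :
    MemLp (fun ω => S.ctrlDev γU γΘ (noise.past k ω) t) 2 P := by
  have h : MemLp (fun ω => ∑ s ∈ Finset.range (t + 1), S.Psi t s *ᵥ noise.past k ω s) 2 P :=
    memLp_finsetSum _ fun s _ => memLp_mulVec _ (memLp_past noise s k)
  have hc : MemLp (fun _ : Ω => S.A ^ t *ᵥ S.mean0) 2 P := memLp_const _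
  exact (memLp_ctrlOf noise γU γΘ t k).add (memLp_mulVec _ ((hc.add (memLp_forced
    (fun s => memLp_ctrlOf noise γU γΘ s k) t)).add h))

lemma integral_W (t : ℕ) : ∫ ω, noise.W t ω ∂P = 0 := by
  rw [← integral_gaussianVec 0 S.covW, ← noise.law_W t,
    integral_map (noise.measurable_W t).aemeasurable (by fun_prop)]

variable [IsProbabilityMeasure P]

lemma ae_ξ_eq (hM : ∀ t < S.T, IsUnit (S.innovCov t)) :
    ∀ᵐ ω ∂P, ∀ s < S.T, (Z s).ξ ω = noise.innov s ω :=
  ae_all_iff.2 fun s => by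
    by_cases hs : s < S.T
    · filter_upwards [closedLoop_ξ_ae_eq noise γU γΘ hM hs] with ω hω _ using hω
    · exact .of_forall fun ω hs' => absurd hs' hs

lemma ae_U_eq (hM : ∀ t < S.T, IsUnit (S.innovCov t)) {k : ℕ} (hk : k ≤ S.T) :
    ∀ᵐ ω ∂P, ∀ t < k, (Z t).U ω = S.ctrlOf γU γΘ (noise.past k ω) t := by
  filter_upwards [ae_ξ_eq noise γU γΘ hM] with ω hω t ht
  rw [closedLoop_U]
  refine ctrlOf_congr fun r hr => ?_
  rw [hω r (by omega), noise.past_apply_of_lt (by omega)]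

lemma ae_sel_eq (hM : ∀ t < S.T, IsUnit (S.innovCov t)) {t : ℕ} (ht : t < S.T) :
    ∀ᵐ ω ∂P, (Z t).sel ω = S.selOf γΘ (noise.past S.T ω) t := by
  filter_upwards [ae_ξ_eq noise γU γΘ hM] with ω hω
  rw [(closedLoop_sel_O noise γU γΘ t ω).1]
  refine selOf_congr fun r hr => ?_
  rw [hω r (by omega), noise.past_apply_of_lt (by omega)]

/-- The process noise is independent of the present state and control, hence does not correlate
with them. -/
lemma integral_W_dotProduct (hM : ∀ t < S.T, IsUnit (S.innovCov t)) {t : ℕ} (ht : t < S.T)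
    (H : Matrix (Fin n) (Fin n) ℝ) :
    ∫ ω, noise.W t ω ⬝ᵥ H *ᵥ (S.A *ᵥ (Z t).X ω + S.B *ᵥ (Z t).U ω) ∂P = 0 := by
  let z' : ((ℕ → Vec p) × Vec n) × Vec p → ℕ → Vec p := fun h =>
    Function.update h.1.1 t (S.C *ᵥ h.1.2 + h.2)
  let Φ : ((ℕ → Vec p) × Vec n) × Vec p → Vec n := fun h =>
    H *ᵥ (S.A *ᵥ (h.1.2 + S.predMean (z' h) (S.ctrlOf γU γΘ (z' h)) t) +
      S.B *ᵥ S.ctrlOf γU γΘ (z' h) t)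
  have mz : Measurable z' := measurable_pi_lambda _ fun s => by
    simp only [z', Function.update_apply]
    split_ifs
    · exact (measurable_const_mulVec _ (measurable_snd.comp measurable_fst)).add measurable_snd
    · exact (measurable_pi_apply s).comp (measurable_fst.comp measurable_fst)
  have mc : ∀ s, Measurable fun h => S.ctrlOf γU γΘ (z' h) s := fun s =>
    (measurable_ctrlOf γU γΘ s).comp mz
  have mΦ : Measurable Φ :=
    measurable_const_mulVec _ ((measurable_const_mulVec _ ((measurable_snd.comp measurable_fst).add
      (measurable_predMean (z := fun s h => z' h s) (u := fun s h => S.ctrlOf γU γΘ (z' h) s)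
        (fun s _ => (measurable_pi_apply s).comp mz) (fun s _ => mc s)))).add
      (measurable_const_mulVec _ (mc t)))
  have h1 := (noise.indepFun_history_W t).comp mΦ measurable_id
  have h2 : Φ ∘ (fun ω => ((noise.past t ω, noise.err t ω), noise.V t ω)) =ᵐ[P]
      fun ω => H *ᵥ (S.A *ᵥ (Z t).X ω + S.B *ᵥ (Z t).U ω) := by
    filter_upwards [ae_U_eq noise γU γΘ hM (k := t + 1) ht] with ω hω
    have hz : z' ((noise.past t ω, noise.err t ω), noise.V t ω) = noise.past (t + 1) ω := by
      rw [Noise.past_succ]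
      rfl
    have hp : S.predMean (noise.past (t + 1) ω) (S.ctrlOf γU γΘ (noise.past (t + 1) ω)) t =
        S.predMean (fun s => noise.innov s ω) (fun s => (Z s).U ω) t := by
      unfold predMean
      rw [forced_congr fun s hs => (hω s (by omega)).symm]
      congr 1
      refine Finset.sum_congr rfl fun s hs => ?_
      have := Finset.mem_range.1 hs
      rw [noise.past_apply_of_lt (by omega)]
    simp only [Function.comp_apply, Φ, hz, hp]
    rw [closedLoop_X, hω t (by omega)]
  have h3 := h1.congr h2 (.of_forall fun _ => rfl)
  simp only [dotProduct_comm (noise.W t _)]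
  exact integral_dotProduct_eq_zero (memLp_mulVec _ ((memLp_mulVec _ (memLp_X noise γU γΘ t)).add
    (memLp_mulVec _ (memLp_U noise γU γΘ t)))) (noise.memLp_W t) h3 (integral_W noise t)

lemma integral_residual (hM : ∀ t < S.T, IsUnit (S.innovCov t)) {t : ℕ} (ht : t < S.T) :
    ∫ ω, noise.residual t ω ∂P = 0 := by
  have h1 := noise.law_err hM ht.le
  have h2 : ∫ ω, noise.err t ω ∂P = 0 := by
    rw [← integral_gaussianVec 0 (S.predCov t), ← h1.2.1,
      integral_map (noise.measurable_err t).aemeasurable (by fun_prop)]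
  unfold Noise.residual
  have i1 := (noise.memLp_err t).integrable one_le_two
  have i2 := (noise.memLp_innov t).integrable one_le_two
  have h3 : ∫ ω, S.kalmanGain t *ᵥ noise.innov t ω ∂P = 0 := by
    have := (LinearMap.toContinuousLinearMap (Matrix.mulVecLin (S.kalmanGain t))).integral_comp_comm
      i2
    rw [integral_innov noise hM ht, map_zero] at this
    exact this
  rw [integral_sub i1 ((memLp_mulVec _ (noise.memLp_innov t)).integrable one_le_two), h2, h3,
    sub_zero]

/-- The deviation of the control from `-L_t X_t` is the sum of two independent terms. -/
lemma integral_deviation (hM : ∀ t < S.T, IsUnit (S.innovCov t)) {t : ℕ} (ht : t < S.T) :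
    ∫ ω, ((Z t).U ω + S.gain t *ᵥ (Z t).X ω) ⬝ᵥ S.stageWeight t *ᵥ
      ((Z t).U ω + S.gain t *ᵥ (Z t).X ω) ∂P =
    ∫ ω, S.ctrlDev γU γΘ (noise.past S.T ω) t ⬝ᵥ S.stageWeight t *ᵥ
      S.ctrlDev γU γΘ (noise.past S.T ω) t ∂P +
    ∫ ω, noise.residual t ω ⬝ᵥ S.weightN t *ᵥ noise.residual t ω ∂P := by
  have h1 : ∀ᵐ ω ∂P, (Z t).U ω + S.gain t *ᵥ (Z t).X ω =
      S.ctrlDev γU γΘ (noise.past S.T ω) t + S.gain t *ᵥ noise.residual t ω := by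
    filter_upwards [ae_U_eq noise γU γΘ hM le_rfl] with ω hω
    have hs : ∑ s ∈ Finset.range (t + 1), S.Psi t s *ᵥ noise.past S.T ω s =
        ∑ s ∈ Finset.range t, S.Psi t s *ᵥ noise.innov s ω + S.kalmanGain t *ᵥ noise.innov t ω := by
      rw [← Psi_self, ← Finset.sum_range_succ]
      refine Finset.sum_congr rfl fun s hs => ?_
      have := Finset.mem_range.1 hs
      rw [noise.past_apply_of_lt (by omega)]
    rw [closedLoop_X, hω t ht, ctrlDev, Noise.residual, predMean, hs,
      forced_congr fun s hs => hω s (by omega)]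
    simp only [mulVec_add, mulVec_sub]
    abel
  have m1 := memLp_ctrlDev noise γU γΘ t S.T
  have m2 := noise.memLp_residual t
  have hi : IndepFun (fun ω => (S.gain t)ᵀ *ᵥ S.stageWeight t *ᵥ
      S.ctrlDev γU γΘ (noise.past S.T ω) t) (noise.residual t) P := by
    refine ((noise.indepFun_past_residual hM ht).comp (measurable_const_mulVec (S.gain t)ᵀ
      (measurable_const_mulVec (S.stageWeight t) (measurable_ctrlDev (S := S) γU γΘ t)))
      measurable_id).congr
      (.of_forall fun ω => ?_) (.of_forall fun _ => rfl)
    simp only [Function.comp_apply]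
    rw [ctrlDev_congr fun r hr => ?_]
    rw [noise.past_apply_of_lt (by omega), noise.past_apply_of_lt (by omega)]
  have h0 := integral_dotProduct_eq_zero (memLp_mulVec _ (memLp_mulVec _ m1)) m2 hi
    (integral_residual noise hM ht)
  have i1 := integrable_dotProduct m1 (memLp_mulVec (S.stageWeight t) m1)
  have i2 := integrable_dotProduct m2 (memLp_mulVec (S.weightN t) m2)
  have i3 := integrable_dotProduct (memLp_mulVec (S.gain t)ᵀ (memLp_mulVec (S.stageWeight t) m1)) m2
  calc _ = ∫ ω, (S.ctrlDev γU γΘ (noise.past S.T ω) t ⬝ᵥ S.stageWeight t *ᵥ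
        S.ctrlDev γU γΘ (noise.past S.T ω) t + 2 * (((S.gain t)ᵀ *ᵥ S.stageWeight t *ᵥ
        S.ctrlDev γU γΘ (noise.past S.T ω) t) ⬝ᵥ noise.residual t ω) +
        noise.residual t ω ⬝ᵥ S.weightN t *ᵥ noise.residual t ω) ∂P := by
        refine integral_congr_ae ?_
        filter_upwards [h1] with ω hω
        rw [hω, quadForm_add (stageWeight_symm t), mulVec_dotProduct_mulVec, ← weightN_eq,
          mulVec_dotProduct_comm (S.gain t)ᵀ, transpose_transpose,
          dotProduct_comm (S.gain t *ᵥ noise.residual t ω)]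
    _ = _ := by
        rw [integral_add (i1.fun_add (i3.const_mul 2)) i2, integral_add i1 (i3.const_mul 2),
          integral_const_mul, h0]
        ring

/-- The cost due to the initial state, the process noise and the filtering errors, which no strategy
influences. -/
noncomputable def baseCost : ℝ :=
  ∫ ω, noise.X0 ω ⬝ᵥ S.costToGo 0 *ᵥ noise.X0 ω ∂P +
    ∑ t ∈ Finset.range S.T, (∫ ω, noise.residual t ω ⬝ᵥ S.weightN t *ᵥ noise.residual t ω ∂P +
      ∫ ω, noise.W t ω ⬝ᵥ S.costToGo (t + 1) *ᵥ noise.W t ω ∂P)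

lemma integrable_of_selOf (g : Fin M → ℝ) (t : ℕ) :
    Integrable (fun ω => g (S.selOf γΘ (noise.past S.T ω) t)) P := by
  refine memLp_one_iff_integrable.1 (memLp_of_finite_range ?_ ((Set.finite_range g).subset ?_))
  · exact ((measurable_of_countable g).comp
      ((measurable_selOf γΘ t).comp (noise.measurable_past S.T))).aestronglyMeasurable
  · rintro _ ⟨ω, rfl⟩
    exact ⟨_, rfl⟩

/-- The expected cost after completing the squares: the strategies enter through the deviations of
the controls and through the prices only. -/
lemma J_eq (hM : ∀ t < S.T, IsUnit (S.innovCov t)) : S.J noise γU γΘ = baseCost noise +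
    ∑ t ∈ Finset.range S.T, (∫ ω, S.ctrlDev γU γΘ (noise.past S.T ω) t ⬝ᵥ S.stageWeight t *ᵥ
      S.ctrlDev γU γΘ (noise.past S.T ω) t ∂P +
      ∫ ω, S.price (S.selOf γΘ (noise.past S.T ω) t) ∂P) := by
  have mX := memLp_X noise γU γΘ
  have mU := memLp_U noise γU γΘ
  have mD : ∀ t, MemLp (fun ω => (Z t).U ω + S.gain t *ᵥ (Z t).X ω) 2 P := fun t =>
    (mU t).add (memLp_mulVec _ (mX t))
  have mS : ∀ t, MemLp (fun ω => S.A *ᵥ (Z t).X ω + S.B *ᵥ (Z t).U ω) 2 P := fun t =>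
    (memLp_mulVec _ (mX t)).add (memLp_mulVec _ (mU t))
  have m0 : MemLp noise.X0 2 P :=
    memLp_of_map_eq_gaussianVec noise.measurable_X0 noise.law_X0
  have i0 := integrable_dotProduct m0 (memLp_mulVec (S.costToGo 0) m0)
  have i1 := fun t => integrable_dotProduct (mD t) (memLp_mulVec (S.stageWeight t) (mD t))
  have i2 := fun t => integrable_dotProduct (noise.memLp_W t)
    (memLp_mulVec (S.costToGo (t + 1)) (mS t))
  have i3 := fun t => integrable_dotProduct (noise.memLp_W t)
    (memLp_mulVec (S.costToGo (t + 1)) (noise.memLp_W t))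
  have i4 := fun t => integrable_of_selOf (γΘ := γΘ) noise S.price t
  have hsel : ∀ᵐ ω ∂P, ∀ t < S.T, (Z t).sel ω = S.selOf γΘ (noise.past S.T ω) t :=
    ae_all_iff.2 fun t => by
      by_cases ht : t < S.T
      · filter_upwards [ae_sel_eq noise γU γΘ hM ht] with ω hω _ using hω
      · exact .of_forall fun ω ht' => absurd ht' ht
  have h : S.J noise γU γΘ = ∫ ω, (noise.X0 ω ⬝ᵥ S.costToGo 0 *ᵥ noise.X0 ω +
      ∑ t ∈ Finset.range S.T, (((Z t).U ω + S.gain t *ᵥ (Z t).X ω) ⬝ᵥ S.stageWeight t *ᵥ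
          ((Z t).U ω + S.gain t *ᵥ (Z t).X ω) +
        2 * (noise.W t ω ⬝ᵥ S.costToGo (t + 1) *ᵥ (S.A *ᵥ (Z t).X ω + S.B *ᵥ (Z t).U ω)) +
        noise.W t ω ⬝ᵥ S.costToGo (t + 1) *ᵥ noise.W t ω +
        S.price (S.selOf γΘ (noise.past S.T ω) t))) ∂P := by
    unfold J
    refine integral_congr_ae ?_
    filter_upwards [hsel] with ω hω
    have h1 := sum_stage_cost (S := S) (x := fun t => (Z t).X ω) (u := fun t => (Z t).U ω)
      (w := fun t => noise.W t ω) (fun t => closedLoop_X_succ noise γU γΘ t ω)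
    rw [closedLoop_X_zero] at h1
    have h2 : ∑ t ∈ Finset.range S.T, S.price ((Z t).sel ω) =
        ∑ t ∈ Finset.range S.T, S.price (S.selOf γΘ (noise.past S.T ω) t) :=
      Finset.sum_congr rfl fun t ht => by rw [hω t (Finset.mem_range.1 ht)]
    rw [Finset.sum_add_distrib, h2, add_right_comm, h1, add_assoc, ← Finset.sum_add_distrib]
  rw [h, integral_add i0 (integrable_finsetSum _ fun t _ =>
      (((i1 t).fun_add ((i2 t).const_mul 2)).fun_add (i3 t)).fun_add (i4 t)),
    integral_finsetSum _ fun t _ =>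
      (((i1 t).fun_add ((i2 t).const_mul 2)).fun_add (i3 t)).fun_add (i4 t),
    baseCost, add_assoc, ← Finset.sum_add_distrib]
  congr 1
  refine Finset.sum_congr rfl fun t ht => ?_
  have ht := Finset.mem_range.1 ht
  rw [integral_add (((i1 t).fun_add ((i2 t).const_mul 2)).fun_add (i3 t)) (i4 t),
    integral_add ((i1 t).fun_add ((i2 t).const_mul 2)) (i3 t),
    integral_add (i1 t) ((i2 t).const_mul 2), integral_const_mul,
    integral_W_dotProduct noise γU γΘ hM ht, integral_deviation noise γU γΘ hM ht]
  ring

end ClosedLoop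

end Problem

/-! ### Centroids of quantization cells -/

section Centroid

variable {Ω : Type*} [MeasurableSpace Ω] {P : Measure Ω}

/-- Let `f X` be centred on each level set of the label `κ X`, and let `Y` be independent of `X`.
Then `f X` is orthogonal to every function of `Y` and of the label `κ X`. -/
lemma integral_mul_eq_zero_of_label {E F : Type*} [MeasurableSpace E] [MeasurableSpace F]
    {X : Ω → E} {Y : Ω → F} (hX : Measurable X) (hY : Measurable Y) (hXY : IndepFun X Y P)
    {f : E → ℝ} (hf : Measurable f) {κ : E → ℕ} (hκ : Measurable κ) {N : ℕ} (hN : ∀ x, κ x < N)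
    (h0 : ∀ j, ∫ ω, {x | κ x = j}.indicator f (X ω) ∂P = 0)
    {g : E × F → ℝ} (hg : Measurable g) (hgκ : ∀ x x' y, κ x = κ x' → g (x, y) = g (x', y))
    (hint : Integrable (fun ω => f (X ω) * g (X ω, Y ω)) P) :
    ∫ ω, f (X ω) * g (X ω, Y ω) ∂P = 0 := by
  have hms : ∀ j, MeasurableSet {x | κ x = j} := fun j => hκ (measurableSet_singleton j)
  have h1 : ∀ ω, f (X ω) * g (X ω, Y ω) = ∑ j ∈ Finset.range N,
      {x | κ x = j}.indicator f (X ω) * g (X ω, Y ω) := fun ω => by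
    rw [← Finset.sum_mul]
    congr 1
    rw [Finset.sum_eq_single (κ (X ω))]
    · simp
    · intro j _ hj
      exact Set.indicator_of_notMem (fun h => hj h.symm) _
    · intro h
      exact absurd (Finset.mem_range.2 (hN _)) h
  have h2 : ∀ j, Integrable (fun ω => {x | κ x = j}.indicator f (X ω) * g (X ω, Y ω)) P := by
    intro j
    have := hint.indicator (hX (hms j))
    refine this.congr (.of_forall fun ω => ?_)
    by_cases h : κ (X ω) = j <;> simp [Set.indicator, h]
  simp only [h1]
  rw [integral_finsetSum _ fun j _ => h2 j]
  refine Finset.sum_eq_zero fun j _ => ?_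
  by_cases hj : ∃ x, κ x = j
  · obtain ⟨x, rfl⟩ := hj
    have h3 : ∀ ω, {x' | κ x' = κ x}.indicator f (X ω) * g (X ω, Y ω) =
        {x' | κ x' = κ x}.indicator f (X ω) * g (x, Y ω) := fun ω => by
      by_cases h : κ (X ω) = κ x
      · rw [hgκ _ _ _ h]
      · simp [Set.indicator, h]
    simp only [h3]
    rw [hXY.integral_fun_comp_mul_comp (f := {x' | κ x' = κ x}.indicator f)
      (g := fun y => g (x, y)) hX.aemeasurable hY.aemeasurable
      (hf.indicator (hms _)).aestronglyMeasurable
      (hg.comp measurable_prodMk_left).aestronglyMeasurable, h0, zero_mul]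
  · have : ∀ ω, {x | κ x = j}.indicator f (X ω) = 0 := fun ω =>
      Set.indicator_of_notMem (s := {x | κ x = j}) (fun h => hj ⟨X ω, h⟩) f
    simp [this]

end Centroid

namespace Problem

variable {n m p M : ℕ} {S : Problem n m p M}

lemma measurableSet_cell (q : Quantizer p) (j : Fin q.levels) : MeasurableSet (q.cell j) :=
  q.measurable_idx (measurableSet_singleton j)

lemma setIntegral_cell (t : ℕ) (i : Fin M) (j : Fin (S.quantizer i).levels) :
    ∫ x in (S.quantizer i).cell j, x ∂(gaussianVec 0 (S.innovCov t)) =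
      (gaussianVec 0 (S.innovCov t)).real ((S.quantizer i).cell j) • S.cellMean t i j := by
  set μ := gaussianVec 0 (S.innovCov t)
  rw [cellMean, ProbabilityTheory.cond, integral_smul_measure]
  by_cases h : μ ((S.quantizer i).cell j) = 0
  · rw [Measure.restrict_eq_zero.2 h]
    simp
  · rw [smul_smul, measureReal_def, ENNReal.toReal_inv, mul_inv_cancel₀, one_smul]
    exact ENNReal.toReal_ne_zero.2 ⟨h, measure_ne_top _ _⟩

variable (S) in
/-- What the controller knows at time `t` of an innovation `x` quantized by the `i`-th quantizer at
time `s`, as a label: a constant before the arrival, the label of the cell afterwards. -/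
noncomputable def label (i : Fin M) (s t : ℕ) (x : Vec p) : ℕ :=
  if s + S.delay i ≤ t then ((S.quantizer i).idx x : ℕ) else 0

variable (S) in
/-- The conditional mean of an innovation `x` quantized by the `i`-th quantizer at time `s`, given
its label at time `t`. -/
noncomputable def centroid (i : Fin M) (s t : ℕ) (x : Vec p) : Vec p :=
  if s + S.delay i ≤ t then S.cellMean s i ((S.quantizer i).idx x) else 0

lemma estOf_eq {γΘ : SelectorPolicy p M} (z : ℕ → Vec p) (s t : ℕ) :
    S.estOf γΘ z s t = S.centroid (S.selOf γΘ z s) s t (z s) := rfl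

lemma measurable_label (i : Fin M) (s t : ℕ) : Measurable (S.label i s t) := by
  unfold label
  split_ifs
  · exact (measurable_of_countable fun j : Fin _ => (j : ℕ)).comp (S.quantizer i).measurable_idx
  · exact measurable_const

lemma measurable_centroid (i : Fin M) (s t : ℕ) : Measurable (S.centroid i s t) := by
  unfold centroid
  split_ifs
  · exact (measurable_of_countable fun j => S.cellMean s i j).comp (S.quantizer i).measurable_idx
  · exact measurable_const

lemma finite_range_centroid (s t : ℕ) :
    (Set.range fun a : Fin M × Vec p => S.centroid a.1 s t a.2).Finite := by
  refine ((Set.finite_iUnion fun i : Fin M =>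
    Set.finite_range fun j => S.cellMean s i j).insert 0).subset ?_
  rintro _ ⟨⟨i, x⟩, rfl⟩
  simp only [centroid]
  split_ifs
  · exact Or.inr (Set.mem_iUnion.2 ⟨i, _, rfl⟩)
  · exact Or.inl rfl

lemma measurable_estOf (γΘ : SelectorPolicy p M) (s t : ℕ) :
    Measurable fun z => S.estOf γΘ z s t := by
  have e : ∀ z, S.estOf γΘ z s t =
      ∑ i, if S.selOf γΘ z s = i then S.centroid i s t (z s) else 0 := fun z => by
    rw [estOf_eq, Finset.sum_ite_eq, if_pos (Finset.mem_univ _)]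
  simp only [e]
  exact Finset.measurable_sum _ fun i _ => Measurable.ite
    (measurable_selOf γΘ s (measurableSet_singleton i))
    ((measurable_centroid i s t).comp (measurable_pi_apply s)) measurable_const

section Loop

variable {Ω : Type*} [MeasurableSpace Ω] {P : Measure Ω} [IsProbabilityMeasure P]
  (noise : Noise S P)

lemma memLp_estOf (γΘ : SelectorPolicy p M) (s t k : ℕ) :
    MemLp (fun ω => S.estOf γΘ (noise.past k ω) s t) 2 P := by
  refine memLp_of_finite_range
    ((measurable_estOf γΘ s t).comp (noise.measurable_past k)).aestronglyMeasurable ?_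
  refine (finite_range_centroid (S := S) s t).subset ?_
  rintro _ ⟨ω, rfl⟩
  exact ⟨(_, _), rfl⟩

lemma memLp_centroid (i : Fin M) (s t : ℕ) :
    MemLp (fun ω => S.centroid i s t (noise.innov s ω)) 2 P := by
  refine memLp_of_finite_range
    ((measurable_centroid i s t).comp (noise.measurable_innov s)).aestronglyMeasurable ?_
  refine (finite_range_centroid (S := S) s t).subset ?_
  rintro _ ⟨ω, rfl⟩
  exact ⟨(_, _), rfl⟩

/-- The quantization error is centred on each level set of the label. -/
lemma integral_label_indicator (hM : ∀ t < S.T, IsUnit (S.innovCov t)) {s : ℕ} (hs : s < S.T)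
    (t : ℕ) (i : Fin M) (k : Fin p) (j : ℕ) :
    ∫ ω, {x | S.label i s t x = j}.indicator (fun x => (x - S.centroid i s t x) k)
      (noise.innov s ω) ∂P = 0 := by
  have hms : MeasurableSet {x | S.label i s t x = j} :=
    measurable_label i s t (measurableSet_singleton j)
  have hmf : Measurable fun x : Vec p => (x - S.centroid i s t x) k :=
    (measurable_pi_apply k).comp (measurable_id.sub (measurable_centroid i s t))
  rw [← integral_map (φ := noise.innov s) (noise.measurable_innov s).aemeasurable
    (hmf.indicator hms).aestronglyMeasurable, noise.law_innov hM hs, integral_indicator hms]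
  set μ := gaussianVec 0 (S.innovCov s)
  have hid : MemLp (fun x : Vec p => x) 2 μ := IsGaussian.memLp_two_id
  by_cases ht : s + S.delay i ≤ t
  · by_cases hj : ∃ l : Fin (S.quantizer i).levels, (l : ℕ) = j
    · obtain ⟨l, rfl⟩ := hj
      have hset : {x | S.label i s t x = l} = (S.quantizer i).cell l := by
        ext x
        simp [label, ht, Quantizer.cell, Fin.ext_iff]
      have hcell : ∀ x ∈ (S.quantizer i).cell l,
          (x - S.centroid i s t x) k = x k - S.cellMean s i l k := fun x hx => by
        have : (S.quantizer i).idx x = l := hx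
        simp [centroid, ht, this]
      rw [hset, setIntegral_congr_fun (measurableSet_cell _ _) hcell, integral_sub
        ((memLp_apply (hid.restrict _) k).integrable one_le_two) (integrable_const _),
        integral_apply (hid.restrict _) k, setIntegral_cell]
      simp [μ, measureReal_def]
    · have hset : {x | S.label i s t x = j} = ∅ := by
        ext x
        simp only [label, ht, if_true, Set.mem_ofPred_eq, Set.mem_empty_iff_false, iff_false]
        exact fun h => hj ⟨_, h⟩
      simp [hset]
  · have hc : ∀ x, (x - S.centroid i s t x) k = x k := fun x => by simp [centroid, ht]
    simp only [hc, label, ht, if_false]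
    by_cases hj : 0 = j
    · simp only [hj, Set.ofPred_true, Measure.restrict_univ]
      rw [integral_apply hid k, integral_gaussianVec]
      rfl
    · simp [hj]

/-- Two sequences of innovations are indistinguishable at time `t` up to the innovation at time `s`
if they agree apart from it, and give the same label to it. -/
def SameData (S : Problem n m p M) (γΘ : SelectorPolicy p M) (s t : ℕ) (z z' : ℕ → Vec p) : Prop :=
  (∀ r ≠ s, z r = z' r) ∧
    S.label (S.selOf γΘ z s) s t (z s) = S.label (S.selOf γΘ z s) s t (z' s)

lemma SameData.selObs {γΘ : SelectorPolicy p M} {s t : ℕ} {z z' : ℕ → Vec p}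
    (h : SameData S γΘ s t z z') {r : ℕ} (hr : r ≤ t) :
    S.selOf γΘ z r = S.selOf γΘ z' r ∧ S.obsOf γΘ z r = S.obsOf γΘ z' r := by
  refine selObs_congr (fun k _ hk' => ?_) hr
  by_cases hks : k = s
  · subst hks
    have := h.2
    simp only [label, hk', if_true] at this
    rw [Quantizer.quantize, Quantizer.quantize, Fin.ext this]
  · rw [h.1 k hks]

lemma SameData.estOf {γΘ : SelectorPolicy p M} {s t : ℕ} {z z' : ℕ → Vec p}
    (h : SameData S γΘ s t z z') {r : ℕ} (hr : r ≤ t) :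
    S.estOf γΘ z r t = S.estOf γΘ z' r t := by
  rw [estOf_eq, estOf_eq, ← (h.selObs hr).1]
  by_cases hrs : r = s
  · subst hrs
    have := h.2
    unfold centroid
    split_ifs with hk
    · simp only [label, hk, if_true] at this
      rw [Fin.ext this]
    · rfl
  · rw [h.1 r hrs]

/-- The error of the conditional mean of the innovation at time `s` given the data up to time `t` is
orthogonal to everything that does not distinguish two values of this innovation with the same
label. -/
lemma integral_estError_dotProduct (hM : ∀ t < S.T, IsUnit (S.innovCov t)) (γΘ : SelectorPolicy p M)
    {s : ℕ} (hs : s < S.T) (t : ℕ) {φ : (ℕ → Vec p) → Vec p} (hφ : Measurable φ)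
    (hφ2 : MemLp (fun ω => φ (noise.past S.T ω)) 2 P)
    (hinv : ∀ z z', SameData S γΘ s t z z' → φ z = φ z') :
    ∫ ω, (noise.innov s ω - S.estOf γΘ (noise.past S.T ω) s t) ⬝ᵥ φ (noise.past S.T ω) ∂P = 0 := by
  let g : Fin M → Fin p → Vec p × (ℕ → Vec p) → ℝ := fun i k a =>
    if S.selOf γΘ (Function.update a.2 s a.1) s = i then φ (Function.update a.2 s a.1) k else 0
  have mu : Measurable fun a : Vec p × (ℕ → Vec p) => Function.update a.2 s a.1 :=
    measurable_pi_lambda _ fun r => by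
      simp only [Function.update_apply]
      split_ifs <;> fun_prop
  have mu0 : Measurable fun z : ℕ → Vec p => Function.update z s 0 :=
    mu.comp (measurable_const.prodMk measurable_id)
  have mg : ∀ i k, Measurable (g i k) := fun i k =>
    Measurable.ite (((measurable_selOf γΘ s).comp mu) (measurableSet_singleton i))
      ((measurable_pi_apply k).comp (hφ.comp mu)) measurable_const
  have hpath : ∀ ω, Function.update (Function.update (noise.past S.T ω) s 0) s (noise.innov s ω) =
      noise.past S.T ω := fun ω => by
    rw [Function.update_idem, ← noise.past_apply_of_lt hs ω, Function.update_eq_self]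
  have hg : ∀ i k ω, g i k (noise.innov s ω, Function.update (noise.past S.T ω) s 0) =
      if S.selOf γΘ (noise.past S.T ω) s = i then φ (noise.past S.T ω) k else 0 := fun i k ω => by
    simp only [g, hpath]
  have hint : ∀ i k, Integrable (fun ω => (noise.innov s ω - S.centroid i s t (noise.innov s ω)) k *
      g i k (noise.innov s ω, Function.update (noise.past S.T ω) s 0)) P := by
    intro i k
    refine (memLp_apply ((noise.memLp_innov s).sub (memLp_centroid noise i s t)) k).integrable_mul
      (q := 2) ?_
    refine ((memLp_apply hφ2 k).indicator (s := {ω | S.selOf γΘ (noise.past S.T ω) s = i})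
      (((measurable_selOf γΘ s).comp (noise.measurable_past S.T)) (measurableSet_singleton
        i))).ae_eq (.of_forall fun ω => ?_)
    simp only [hg, Set.indicator, Set.mem_ofPred_eq]
  have h0 : ∀ i k, ∫ ω, (noise.innov s ω - S.centroid i s t (noise.innov s ω)) k *
      g i k (noise.innov s ω, Function.update (noise.past S.T ω) s 0) ∂P = 0 := by
    intro i k
    have mf : Measurable fun x : Vec p => (x - S.centroid i s t x) k :=
      (measurable_pi_apply k).comp (measurable_id.sub (measurable_centroid i s t))
    refine integral_mul_eq_zero_of_label (noise.measurable_innov s)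
      (mu0.comp (noise.measurable_past S.T)) (noise.indepFun_innov_update hM hs le_rfl) mf
      (measurable_label i s t) (N := (S.quantizer i).levels + 1) (fun x => ?_)
      (integral_label_indicator noise hM hs t i k) (mg i k) (fun x x' y hxx => ?_) (hint i k)
    · unfold label
      split_ifs <;> omega
    · have hsel : S.selOf γΘ (Function.update y s x) s = S.selOf γΘ (Function.update y s x') s :=
        selOf_congr fun r hr => by rw [Function.update_of_ne hr.ne, Function.update_of_ne hr.ne]
      simp only [g, ← hsel]
      split_ifs with hi
      · have hsame : SameData S γΘ s t (Function.update y s x) (Function.update y s x') :=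
          ⟨fun r hr => by rw [Function.update_of_ne hr, Function.update_of_ne hr],
            by simpa [hi] using hxx⟩
        rw [hinv _ _ hsame]
      · rfl
  have hsum : ∀ ω, (noise.innov s ω - S.estOf γΘ (noise.past S.T ω) s t) ⬝ᵥ φ (noise.past S.T ω) =
      ∑ k, ∑ i, (noise.innov s ω - S.centroid i s t (noise.innov s ω)) k *
        g i k (noise.innov s ω, Function.update (noise.past S.T ω) s 0) := by
    intro ω
    unfold dotProduct
    refine Finset.sum_congr rfl fun k _ => ?_
    rw [Finset.sum_eq_single (S.selOf γΘ (noise.past S.T ω) s)]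
    · rw [hg, if_pos rfl, estOf_eq, noise.past_apply_of_lt hs]
    · intro i _ hi
      rw [hg, if_neg (Ne.symm hi), mul_zero]
    · simp
  simp only [hsum]
  rw [integral_finsetSum _ fun k _ => integrable_finsetSum _ fun i _ => hint i k]
  refine Finset.sum_eq_zero fun k _ => ?_
  rw [integral_finsetSum _ fun i _ => hint i k]
  exact Finset.sum_eq_zero fun i _ => h0 i k

end Loop

end Problem

/-! ### The cost as a sum of nonnegative excesses -/

namespace Problem

variable {n m p M : ℕ} (S : Problem n m p M)

/-- The deviation of the control at time `t` from the certainty-equivalent control, as a function of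
the innovations. -/
noncomputable def dataDev (γU : ControlPolicy m p M) (γΘ : SelectorPolicy p M) (z : ℕ → Vec p)
    (t : ℕ) : Vec m :=
  S.ctrlOf γU γΘ z t + S.gain t *ᵥ (S.A ^ t *ᵥ S.mean0 + S.forced (S.ctrlOf γU γΘ z) t +
    ∑ s ∈ Finset.range (t + 1), S.Psi t s *ᵥ S.estOf γΘ z s t)

variable {S} {γU : ControlPolicy m p M} {γΘ : SelectorPolicy p M}

lemma dataDev_certainty (z : ℕ → Vec p) (t : ℕ) : S.dataDev S.certainty γΘ z t = 0 := by
  rw [dataDev, ctrlOf_certainty, neg_add_cancel]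

lemma ctrlDev_eq (z : ℕ → Vec p) (t : ℕ) : S.ctrlDev γU γΘ z t = S.dataDev γU γΘ z t +
    ∑ s ∈ Finset.range (t + 1), (S.gain t * S.Psi t s) *ᵥ (z s - S.estOf γΘ z s t) := by
  have h : ∑ s ∈ Finset.range (t + 1), (S.gain t * S.Psi t s) *ᵥ (z s - S.estOf γΘ z s t) =
      S.gain t *ᵥ ∑ s ∈ Finset.range (t + 1), S.Psi t s *ᵥ z s -
        S.gain t *ᵥ ∑ s ∈ Finset.range (t + 1), S.Psi t s *ᵥ S.estOf γΘ z s t := by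
    rw [← mulVec_sub, ← Finset.sum_sub_distrib, Matrix.mulVec_sum]
    exact Finset.sum_congr rfl fun s _ => by rw [← mulVec_mulVec, mulVec_sub]
  rw [h, ctrlDev, dataDev]
  simp only [mulVec_add]
  abel

lemma measurable_dataDev (γU : ControlPolicy m p M) (γΘ : SelectorPolicy p M) (t : ℕ) :
    Measurable fun z => S.dataDev γU γΘ z t := by
  have h : Measurable fun z : ℕ → Vec p =>
      ∑ s ∈ Finset.range (t + 1), S.Psi t s *ᵥ S.estOf γΘ z s t :=
    Finset.measurable_sum _ fun s _ => measurable_const_mulVec _ (measurable_estOf γΘ s t)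
  exact (measurable_ctrlOf γU γΘ t).add (measurable_const_mulVec _ ((measurable_const.add
    (measurable_forced (u := fun s z => S.ctrlOf γU γΘ z s)
      fun s _ => measurable_ctrlOf γU γΘ s)).add h))

lemma SameData.dataDev {s t : ℕ} {z z' : ℕ → Vec p} (h : SameData S γΘ s t z z') :
    S.dataDev γU γΘ z t = S.dataDev γU γΘ z' t := by
  have hc : ∀ r ≤ t, S.ctrlOf γU γΘ z r = S.ctrlOf γU γΘ z' r := fun r hr =>
    ctrlOf_congr_of_obsOf fun k hk => (h.selObs (hk.trans hr)).2
  have he : ∑ s ∈ Finset.range (t + 1), S.Psi t s *ᵥ S.estOf γΘ z s t =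
      ∑ s ∈ Finset.range (t + 1), S.Psi t s *ᵥ S.estOf γΘ z' s t :=
    Finset.sum_congr rfl fun r hr => by
      rw [h.estOf (Nat.lt_succ_iff.1 (Finset.mem_range.1 hr))]
  rw [Problem.dataDev, Problem.dataDev, hc t le_rfl, he, forced_congr fun r hr => hc r hr.le]

lemma weightNtilde_eq (s t : ℕ) : S.weightNtilde s t =
    (S.gain t * S.Psi t s)ᵀ * S.stageWeight t * (S.gain t * S.Psi t s) := by
  rw [weightNtilde, weightN_eq, transpose_mul]
  simp only [Matrix.mul_assoc]

lemma weightNtilde_symm (s t : ℕ) : (S.weightNtilde s t)ᵀ = S.weightNtilde s t := by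
  rw [weightNtilde_eq]
  simp only [transpose_mul, transpose_transpose, stageWeight_symm, Matrix.mul_assoc]

/-- Expansion of a quadratic form at a sum. -/
lemma quadForm_add_sum {k l : ℕ} {G : Matrix (Fin l) (Fin l) ℝ} (hG : Gᵀ = G) (d : Vec l)
    (F : Finset ℕ) (K : ℕ → Matrix (Fin l) (Fin k) ℝ) (r : ℕ → Vec k) :
    (d + ∑ s ∈ F, K s *ᵥ r s) ⬝ᵥ G *ᵥ (d + ∑ s ∈ F, K s *ᵥ r s) =
      d ⬝ᵥ G *ᵥ d + 2 * ∑ s ∈ F, r s ⬝ᵥ (K s)ᵀ *ᵥ G *ᵥ d +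
        ∑ s ∈ F, ∑ s' ∈ F, r s ⬝ᵥ ((K s)ᵀ * G * K s') *ᵥ r s' := by
  rw [quadForm_add hG]
  congr 1
  · congr 2
    rw [sum_dotProduct]
    exact Finset.sum_congr rfl fun s _ => mulVec_dotProduct_comm _ _ _
  · rw [sum_dotProduct]
    refine Finset.sum_congr rfl fun s _ => ?_
    rw [Matrix.mulVec_sum, dotProduct_sum]
    exact Finset.sum_congr rfl fun s' _ => mulVec_dotProduct_mulVec _ _ _ _ _

lemma trace_mul_covReduction (H : Matrix (Fin p) (Fin p) ℝ) (t : ℕ) (i : Fin M) :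
    (H * S.covReduction t i).trace = ∑ j, (gaussianVec 0 (S.innovCov t)).real
      ((S.quantizer i).cell j) * (S.cellMean t i j ⬝ᵥ H *ᵥ S.cellMean t i j) := by
  rw [covReduction, Matrix.mul_sum, trace_sum]
  refine Finset.sum_congr rfl fun j _ => ?_
  rw [Matrix.mul_smul, trace_smul, mul_vecMulVec, trace_vecMulVec, smul_eq_mul, dotProduct_comm]

section Excess

variable {Ω : Type*} [MeasurableSpace Ω] {P : Measure Ω} (noise : Noise S P)

/-- The least possible cost; the last sum is the minimal total of the quantities `c`. -/
noncomputable def minCost : ℝ :=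
  baseCost noise + ∑ t ∈ Finset.range S.T, ∑ s ∈ Finset.range (t + 1),
    ∫ ω, noise.innov s ω ⬝ᵥ S.weightNtilde s t *ᵥ noise.innov s ω ∂P +
    ∑ t ∈ Finset.range S.T, ⨅ i, S.c t i

/-- The excess cost caused by the deviation from the certainty-equivalent controls. -/
noncomputable def ctrlExcess (γU : ControlPolicy m p M) (γΘ : SelectorPolicy p M) : ℝ :=
  ∑ t ∈ Finset.range S.T, ∫ ω, S.dataDev γU γΘ (noise.past S.T ω) t ⬝ᵥ S.stageWeight t *ᵥ
    S.dataDev γU γΘ (noise.past S.T ω) t ∂P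

/-- The excess cost caused by the selection of quantizers that do not minimize `c`. -/
noncomputable def selExcess (γΘ : SelectorPolicy p M) : ℝ :=
  ∑ t ∈ Finset.range S.T, ∫ ω, (fun i => S.c t i - ⨅ i, S.c t i)
    (S.selOf γΘ (noise.past S.T ω) t) ∂P

lemma ctrlExcess_nonneg (γU : ControlPolicy m p M) (γΘ : SelectorPolicy p M) :
    0 ≤ ctrlExcess noise γU γΘ :=
  Finset.sum_nonneg fun t _ => integral_nonneg fun _ =>
    PosSemidef.nonneg (stageWeight_posDef t).posSemidef _

lemma ctrlExcess_certainty (γΘ : SelectorPolicy p M) :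
    ctrlExcess noise S.certainty γΘ = 0 := by
  simp [ctrlExcess, dataDev_certainty]

lemma iInf_c_le (t : ℕ) (i : Fin M) : ⨅ i, S.c t i ≤ S.c t i :=
  ciInf_le (Set.finite_range _).bddBelow i

lemma selExcess_nonneg (γΘ : SelectorPolicy p M) : 0 ≤ selExcess noise γΘ :=
  Finset.sum_nonneg fun t _ => integral_nonneg fun _ => sub_nonneg.2 (iInf_c_le t _)

end Excess

section Loop

variable {Ω : Type*} [MeasurableSpace Ω] {P : Measure Ω} [IsProbabilityMeasure P]
  (noise : Noise S P)

lemma memLp_dataDev (γU : ControlPolicy m p M) (γΘ : SelectorPolicy p M) (t k : ℕ) :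
    MemLp (fun ω => S.dataDev γU γΘ (noise.past k ω) t) 2 P := by
  have h : MemLp (fun ω => ∑ s ∈ Finset.range (t + 1),
      S.Psi t s *ᵥ S.estOf γΘ (noise.past k ω) s t) 2 P :=
    memLp_finsetSum _ fun s _ => memLp_mulVec _ (memLp_estOf noise γΘ s t k)
  have hc : MemLp (fun _ : Ω => S.A ^ t *ᵥ S.mean0) 2 P := memLp_const _
  exact (memLp_ctrlOf noise γU γΘ t k).add (memLp_mulVec _ ((hc.add (memLp_forced
    (fun s => memLp_ctrlOf noise γU γΘ s k) t)).add h))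

lemma memLp_estError (γΘ : SelectorPolicy p M) (s t : ℕ) :
    MemLp (fun ω => noise.innov s ω - S.estOf γΘ (noise.past S.T ω) s t) 2 P :=
  (noise.memLp_innov s).sub (memLp_estOf noise γΘ s t S.T)

/-- Estimation errors of different innovations are uncorrelated. -/
lemma integral_estError_cross (hM : ∀ t < S.T, IsUnit (S.innovCov t)) (γΘ : SelectorPolicy p M)
    {s s' t : ℕ} (hs : s < S.T) (hs' : s' < S.T) (hst : s' ≤ t) (hne : s ≠ s')
    (H : Matrix (Fin p) (Fin p) ℝ) :
    ∫ ω, (noise.innov s ω - S.estOf γΘ (noise.past S.T ω) s t) ⬝ᵥ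
      H *ᵥ (noise.innov s' ω - S.estOf γΘ (noise.past S.T ω) s' t) ∂P = 0 := by
  have h := integral_estError_dotProduct noise hM γΘ hs t
    (φ := fun z => H *ᵥ (z s' - S.estOf γΘ z s' t))
    (measurable_const_mulVec _ ((measurable_pi_apply s').sub (measurable_estOf γΘ s' t)))
    (memLp_mulVec _ ((memLp_past noise s' S.T).sub (memLp_estOf noise γΘ s' t S.T)))
    (fun z z' hz => by rw [hz.1 s' hne.symm, hz.estOf hst])
  simpa only [noise.past_apply_of_lt hs'] using h

/-- The estimation error of an innovation is uncorrelated with its estimate. -/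
lemma integral_estError_estOf (hM : ∀ t < S.T, IsUnit (S.innovCov t)) (γΘ : SelectorPolicy p M)
    {s t : ℕ} (hs : s < S.T) (hst : s ≤ t) (H : Matrix (Fin p) (Fin p) ℝ) :
    ∫ ω, (noise.innov s ω - S.estOf γΘ (noise.past S.T ω) s t) ⬝ᵥ
      H *ᵥ S.estOf γΘ (noise.past S.T ω) s t ∂P = 0 :=
  integral_estError_dotProduct noise hM γΘ hs t (φ := fun z => H *ᵥ S.estOf γΘ z s t)
    (measurable_const_mulVec _ (measurable_estOf γΘ s t))
    (memLp_mulVec _ (memLp_estOf noise γΘ s t S.T)) (fun z z' hz => by rw [hz.estOf hst])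

lemma integral_estError_sq (hM : ∀ t < S.T, IsUnit (S.innovCov t)) (γΘ : SelectorPolicy p M)
    {s t : ℕ} (hs : s < S.T) (hst : s ≤ t) {H : Matrix (Fin p) (Fin p) ℝ} (hH : Hᵀ = H) :
    ∫ ω, (noise.innov s ω - S.estOf γΘ (noise.past S.T ω) s t) ⬝ᵥ
      H *ᵥ (noise.innov s ω - S.estOf γΘ (noise.past S.T ω) s t) ∂P =
    ∫ ω, noise.innov s ω ⬝ᵥ H *ᵥ noise.innov s ω ∂P -
      ∫ ω, S.estOf γΘ (noise.past S.T ω) s t ⬝ᵥ H *ᵥ S.estOf γΘ (noise.past S.T ω) s t ∂P := by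
  have mr := memLp_estError noise γΘ s t
  have me := memLp_estOf noise γΘ s t S.T
  have i1 := integrable_dotProduct mr (memLp_mulVec H mr)
  have i2 := integrable_dotProduct mr (memLp_mulVec H me)
  have i3 := integrable_dotProduct me (memLp_mulVec H me)
  have h : ∀ ω, noise.innov s ω ⬝ᵥ H *ᵥ noise.innov s ω =
      S.estOf γΘ (noise.past S.T ω) s t ⬝ᵥ H *ᵥ S.estOf γΘ (noise.past S.T ω) s t +
      2 * ((noise.innov s ω - S.estOf γΘ (noise.past S.T ω) s t) ⬝ᵥ
        H *ᵥ S.estOf γΘ (noise.past S.T ω) s t) +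
      (noise.innov s ω - S.estOf γΘ (noise.past S.T ω) s t) ⬝ᵥ
        H *ᵥ (noise.innov s ω - S.estOf γΘ (noise.past S.T ω) s t) := fun ω => by
    rw [← quadForm_add hH, add_sub_cancel]
  simp only [h]
  rw [integral_add (i3.fun_add (i2.const_mul 2)) i1, integral_add i3 (i2.const_mul 2),
    integral_const_mul, integral_estError_estOf noise hM γΘ hs hst]
  ring

/-- The selection at time `s` depends on the past only, hence is independent of the innovation. -/
lemma integral_selOf_innov (hM : ∀ t < S.T, IsUnit (S.innovCov t)) (γΘ : SelectorPolicy p M)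
    {s : ℕ} (hs : s < S.T) {g : Fin M → Vec p → ℝ} (hg : ∀ i, Measurable (g i))
    (hint : ∀ i, Integrable (fun ω => g i (noise.innov s ω)) P) :
    ∫ ω, g (S.selOf γΘ (noise.past S.T ω) s) (noise.innov s ω) ∂P =
      ∫ ω, (fun i => ∫ x, g i x ∂(gaussianVec 0 (S.innovCov s)))
        (S.selOf γΘ (noise.past S.T ω) s) ∂P := by
  let χ : Fin M → (ℕ → Vec p) → ℝ := fun i z => if S.selOf γΘ z s = i then 1 else 0
  have mχ : ∀ i, Measurable (χ i) := fun i =>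
    Measurable.ite (measurable_selOf γΘ s (measurableSet_singleton i)) measurable_const
      measurable_const
  have hsel : ∀ ω, S.selOf γΘ (noise.past S.T ω) s = S.selOf γΘ (noise.past s ω) s := fun ω =>
    selOf_congr fun r hr => by
      rw [noise.past_apply_of_lt hr, noise.past_apply_of_lt (hr.trans hs)]
  have e : ∀ (a : Fin M → ℝ) ω, a (S.selOf γΘ (noise.past S.T ω) s) =
      ∑ i, χ i (noise.past s ω) * a i := fun a ω => by
    simp [χ, hsel]
  have hχ : ∀ i ω, ‖χ i (noise.past s ω)‖ ≤ 1 := fun i ω => by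
    simp only [χ]
    split_ifs <;> simp
  have i1 : ∀ i, Integrable (fun ω => χ i (noise.past s ω) * g i (noise.innov s ω)) P := fun i =>
    (hint i).bdd_mul ((mχ i).comp (noise.measurable_past s)).aestronglyMeasurable
      (.of_forall (hχ i))
  have i2 : ∀ i (a : ℝ), Integrable (fun ω => χ i (noise.past s ω) * a) P := fun i a =>
    (integrable_const a).bdd_mul ((mχ i).comp (noise.measurable_past s)).aestronglyMeasurable
      (.of_forall (hχ i))
  simp only [e (fun i => ∫ x, g i x ∂(gaussianVec 0 (S.innovCov s))),
    fun ω => e (fun i => g i (noise.innov s ω)) ω]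
  rw [integral_finsetSum _ fun i _ => i1 i, integral_finsetSum _ fun i _ => i2 i _]
  refine Finset.sum_congr rfl fun i _ => ?_
  rw [(noise.indepFun_past_innov hM hs).integral_fun_comp_mul_comp
    (noise.measurable_past s).aemeasurable (noise.measurable_innov s).aemeasurable
    (mχ i).aestronglyMeasurable (hg i).aestronglyMeasurable, integral_mul_const,
    ← noise.law_innov hM hs, integral_map (noise.measurable_innov s).aemeasurable
      (hg i).aestronglyMeasurable]

lemma integral_centroid_sq (i : Fin M) {s t : ℕ} (hst : s ≤ t) (H : Matrix (Fin p) (Fin p) ℝ) :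
    ∫ x, S.centroid i s t x ⬝ᵥ H *ᵥ S.centroid i s t x ∂(gaussianVec 0 (S.innovCov s)) =
      S.Phi (t - s) i * (H * S.covReduction s i).trace := by
  have hd : s + S.delay i ≤ t ↔ S.delay i ≤ t - s := by omega
  rw [trace_mul_covReduction]
  unfold centroid Phi
  simp only [hd]
  split_ifs with h
  · set μ := gaussianVec 0 (S.innovCov s)
    have mi := (S.quantizer i).measurable_idx
    have := Measure.isProbabilityMeasure_map (μ := μ) mi.aemeasurable
    rw [← integral_map (φ := (S.quantizer i).idx) (f := fun j => S.cellMean s i j ⬝ᵥ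
      H *ᵥ S.cellMean s i j) mi.aemeasurable
      (measurable_of_countable _).aestronglyMeasurable, integral_fintype (.of_finite), one_mul]
    refine Finset.sum_congr rfl fun j _ => ?_
    rw [measureReal_def, Measure.map_apply mi (measurableSet_singleton j), smul_eq_mul]
    rfl
  · simp

lemma integral_estOf_sq (hM : ∀ t < S.T, IsUnit (S.innovCov t)) (γΘ : SelectorPolicy p M)
    {s t : ℕ} (hs : s < S.T) (hst : s ≤ t) (H : Matrix (Fin p) (Fin p) ℝ) :
    ∫ ω, S.estOf γΘ (noise.past S.T ω) s t ⬝ᵥ H *ᵥ S.estOf γΘ (noise.past S.T ω) s t ∂P =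
      ∫ ω, (fun i => S.Phi (t - s) i * (H * S.covReduction s i).trace)
        (S.selOf γΘ (noise.past S.T ω) s) ∂P := by
  have h := integral_selOf_innov noise hM γΘ hs
    (g := fun i x => S.centroid i s t x ⬝ᵥ H *ᵥ S.centroid i s t x)
    (fun i => measurable_dotProduct (measurable_centroid i s t)
      (measurable_const_mulVec _ (measurable_centroid i s t)))
    (fun i => integrable_dotProduct (memLp_centroid noise i s t)
      (memLp_mulVec H (memLp_centroid noise i s t)))
  simp only [integral_centroid_sq _ hst] at h
  rw [← h]
  simp only [estOf_eq, noise.past_apply_of_lt hs]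

/-- The mean square deviation of the control splits into the deviation from the
certainty-equivalent control and the estimation errors of the innovations. -/
lemma integral_ctrlDev_sq (hM : ∀ t < S.T, IsUnit (S.innovCov t)) (γU : ControlPolicy m p M)
    (γΘ : SelectorPolicy p M) {t : ℕ} (ht : t < S.T) :
    ∫ ω, S.ctrlDev γU γΘ (noise.past S.T ω) t ⬝ᵥ S.stageWeight t *ᵥ
      S.ctrlDev γU γΘ (noise.past S.T ω) t ∂P =
    ∫ ω, S.dataDev γU γΘ (noise.past S.T ω) t ⬝ᵥ S.stageWeight t *ᵥ
      S.dataDev γU γΘ (noise.past S.T ω) t ∂P +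
    ∑ s ∈ Finset.range (t + 1), (∫ ω, noise.innov s ω ⬝ᵥ S.weightNtilde s t *ᵥ noise.innov s ω ∂P -
      ∫ ω, (fun i => S.Phi (t - s) i * (S.weightNtilde s t * S.covReduction s i).trace)
        (S.selOf γΘ (noise.past S.T ω) s) ∂P) := by
  let r : ℕ → Ω → Vec p := fun s ω => noise.innov s ω - S.estOf γΘ (noise.past S.T ω) s t
  let K : ℕ → Matrix (Fin m) (Fin p) ℝ := fun s => S.gain t * S.Psi t s
  have md := memLp_dataDev noise γU γΘ t S.T
  have mr : ∀ s, MemLp (r s) 2 P := fun s => memLp_estError noise γΘ s t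
  have i0 := integrable_dotProduct md (memLp_mulVec (S.stageWeight t) md)
  have i1 := fun s => integrable_dotProduct (mr s)
    (memLp_mulVec (K s)ᵀ (memLp_mulVec (S.stageWeight t) md))
  have i2 := fun s s' => integrable_dotProduct (mr s)
    (memLp_mulVec ((K s)ᵀ * S.stageWeight t * K s') (mr s'))
  have h : ∀ ω, S.ctrlDev γU γΘ (noise.past S.T ω) t ⬝ᵥ S.stageWeight t *ᵥ
      S.ctrlDev γU γΘ (noise.past S.T ω) t =
      S.dataDev γU γΘ (noise.past S.T ω) t ⬝ᵥ S.stageWeight t *ᵥ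
        S.dataDev γU γΘ (noise.past S.T ω) t +
      2 * ∑ s ∈ Finset.range (t + 1), r s ω ⬝ᵥ (K s)ᵀ *ᵥ S.stageWeight t *ᵥ
        S.dataDev γU γΘ (noise.past S.T ω) t +
      ∑ s ∈ Finset.range (t + 1), ∑ s' ∈ Finset.range (t + 1),
        r s ω ⬝ᵥ ((K s)ᵀ * S.stageWeight t * K s') *ᵥ r s' ω := fun ω => by
    have hr : S.ctrlDev γU γΘ (noise.past S.T ω) t = S.dataDev γU γΘ (noise.past S.T ω) t +
        ∑ s ∈ Finset.range (t + 1), K s *ᵥ r s ω := by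
      rw [ctrlDev_eq]
      congr 1
      refine Finset.sum_congr rfl fun s hs => ?_
      have := Finset.mem_range.1 hs
      rw [noise.past_apply_of_lt (by omega)]
    rw [hr, quadForm_add_sum (stageWeight_symm t)]
  simp only [h]
  rw [integral_add (i0.fun_add ((integrable_finsetSum _ fun s _ => i1 s).const_mul 2))
      (integrable_finsetSum _ fun s _ => integrable_finsetSum _ fun s' _ => i2 s s'),
    integral_add i0 ((integrable_finsetSum _ fun s _ => i1 s).const_mul 2), integral_const_mul,
    integral_finsetSum _ fun s _ => i1 s,
    integral_finsetSum _ fun s _ => integrable_finsetSum _ fun s' _ => i2 s s']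
  have z1 : ∑ s ∈ Finset.range (t + 1), ∫ ω, r s ω ⬝ᵥ (K s)ᵀ *ᵥ S.stageWeight t *ᵥ
      S.dataDev γU γΘ (noise.past S.T ω) t ∂P = 0 := by
    refine Finset.sum_eq_zero fun s hs => ?_
    have := Finset.mem_range.1 hs
    exact integral_estError_dotProduct noise hM γΘ (show s < S.T by omega) t
      (φ := fun z => (K s)ᵀ *ᵥ S.stageWeight t *ᵥ S.dataDev γU γΘ z t)
      (measurable_const_mulVec _ (measurable_const_mulVec _ (measurable_dataDev γU γΘ t)))
      (memLp_mulVec _ (memLp_mulVec _ md)) (fun z z' hz => by rw [hz.dataDev])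
  rw [z1, mul_zero, add_zero]
  congr 1
  refine Finset.sum_congr rfl fun s hs => ?_
  have hst := Nat.lt_succ_iff.1 (Finset.mem_range.1 hs)
  rw [integral_finsetSum _ fun s' _ => i2 s s', Finset.sum_eq_single s]
  · rw [← weightNtilde_eq, ← integral_estOf_sq noise hM γΘ (by omega) hst]
    exact integral_estError_sq noise hM γΘ (by omega) hst (weightNtilde_symm s t)
  · intro s' hs' hne
    have := Finset.mem_range.1 hs'
    exact integral_estError_cross noise hM γΘ (by omega) (by omega) (by omega) hne.symm _
  · exact fun h => absurd hs h

variable (S) in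
lemma c_eq (s : ℕ) (i : Fin M) : S.c s i = S.price i - ∑ t ∈ Finset.Ico s S.T,
    S.Phi (t - s) i * (S.weightNtilde s t * S.covReduction s i).trace := by
  rw [c, Matrix.sum_mul, trace_sum]
  congr 1
  exact Finset.sum_congr rfl fun t _ => by rw [Matrix.smul_mul, trace_smul, smul_eq_mul]

/-- The control strategy enters the first excess only, and the second excess is governed by the
offline quantities `c` alone. -/
lemma J_eq_minCost_add (hM : ∀ t < S.T, IsUnit (S.innovCov t)) (γU : ControlPolicy m p M)
    (γΘ : SelectorPolicy p M) :
    S.J noise γU γΘ = minCost noise + ctrlExcess noise γU γΘ + selExcess noise γΘ := by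
  let f : ℕ → ℕ → ℝ := fun s t => ∫ ω, (fun i => S.Phi (t - s) i *
    (S.weightNtilde s t * S.covReduction s i).trace) (S.selOf γΘ (noise.past S.T ω) s) ∂P
  have hswap : ∑ t ∈ Finset.range S.T, ∑ s ∈ Finset.range (t + 1), f s t =
      ∑ s ∈ Finset.range S.T, ∑ t ∈ Finset.Ico s S.T, f s t := by
    refine Finset.sum_comm' fun t s => ?_
    simp only [Finset.mem_range, Finset.mem_Ico]
    omega
  have hc : ∀ s, ∫ ω, (fun i => S.c s i - ⨅ i, S.c s i) (S.selOf γΘ (noise.past S.T ω) s) ∂P =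
      ∫ ω, S.price (S.selOf γΘ (noise.past S.T ω) s) ∂P - ∑ t ∈ Finset.Ico s S.T, f s t -
        ⨅ i, S.c s i := fun s => by
    have ip := integrable_of_selOf (γΘ := γΘ) noise S.price s
    have it := fun t => integrable_of_selOf (γΘ := γΘ) noise (fun i => S.Phi (t - s) i *
      (S.weightNtilde s t * S.covReduction s i).trace) s
    simp only [c_eq]
    have isub := ip.sub (integrable_finsetSum (Finset.Ico s S.T) fun t _ => it t)
    simp only [Pi.sub_def] at isub
    rw [integral_sub isub (integrable_const _),
      integral_sub ip (integrable_finsetSum _ fun t _ => it t),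
      integral_finsetSum _ fun t _ => it t, integral_const, probReal_univ, one_smul]
  rw [J_eq noise γU γΘ hM, Finset.sum_add_distrib, Finset.sum_congr rfl fun t ht =>
    integral_ctrlDev_sq noise hM γU γΘ (Finset.mem_range.1 ht), selExcess,
    Finset.sum_congr rfl fun s _ => hc s, minCost, ctrlExcess]
  simp only [Finset.sum_add_distrib, Finset.sum_sub_distrib]
  rw [← hswap]
  ring

lemma selExcess_eq_zero_iff (γΘ : SelectorPolicy p M) : selExcess noise γΘ = 0 ↔
    ∀ t < S.T, ∀ᵐ ω ∂P, S.c t (S.selOf γΘ (noise.past S.T ω) t) = ⨅ i, S.c t i := by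
  rw [selExcess, Finset.sum_eq_zero_iff_of_nonneg fun t _ =>
    integral_nonneg fun _ => sub_nonneg.2 (iInf_c_le t _)]
  refine forall_congr' fun t => ?_
  rw [Finset.mem_range]
  refine imp_congr_right fun _ => ?_
  rw [integral_eq_zero_iff_of_nonneg (fun _ => sub_nonneg.2 (iInf_c_le t _))
    (integrable_of_selOf (γΘ := γΘ) noise (fun i => S.c t i - ⨅ i, S.c t i) t)]
  refine Filter.eventually_congr (.of_forall fun ω => ?_)
  simp [sub_eq_zero]

/-- The selection strategy that uses the quantizer `σ t` at time `t`, whatever happens. -/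
def openLoop (σ : ℕ → Fin M) : SelectorPolicy p M where
  act t _ := σ t
  measurable_act _ := measurable_const

lemma selOf_openLoop (σ : ℕ → Fin M) (z : ℕ → Vec p) (t : ℕ) :
    S.selOf (openLoop σ) z t = σ t := by
  rw [selOf_eq]
  rfl

lemma selExcess_openLoop {σ : ℕ → Fin M} (h : ∀ t < S.T, S.c t (σ t) = ⨅ i, S.c t i) :
    selExcess noise (openLoop σ) = 0 := by
  rw [selExcess_eq_zero_iff]
  intro t ht
  simp [selOf_openLoop, h t ht]

lemma exists_c_eq_iInf [Nonempty (Fin M)] : ∃ σ : ℕ → Fin M, ∀ t, S.c t (σ t) = ⨅ i, S.c t i :=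
  ⟨fun t => (exists_eq_ciInf_of_finite (f := S.c t)).choose,
    fun t => (exists_eq_ciInf_of_finite (f := S.c t)).choose_spec⟩

/-- Both excesses vanish for the certainty-equivalent controller together with a selection of
minimizers of `c`, so they vanish for all optimal pairs. -/
lemma isOptimal_iff [Nonempty (Fin M)] (hM : ∀ t < S.T, IsUnit (S.innovCov t))
    (γU : ControlPolicy m p M) (γΘ : SelectorPolicy p M) :
    S.IsOptimal noise γU γΘ ↔ ctrlExcess noise γU γΘ = 0 ∧ selExcess noise γΘ = 0 := by
  have h1 := ctrlExcess_nonneg noise γU γΘ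
  have h2 := selExcess_nonneg noise γΘ
  constructor
  · intro h
    obtain ⟨σ, hσ⟩ := exists_c_eq_iInf (S := S)
    have h3 := h S.certainty (openLoop σ)
    rw [J_eq_minCost_add noise hM, J_eq_minCost_add noise hM, ctrlExcess_certainty,
      selExcess_openLoop noise fun t _ => hσ t] at h3
    constructor <;> linarith
  · rintro ⟨h3, h4⟩ γU' γΘ'
    rw [J_eq_minCost_add noise hM, J_eq_minCost_add noise hM, h3, h4]
    linarith [ctrlExcess_nonneg noise γU' γΘ', selExcess_nonneg noise γΘ']

lemma selExcess_eq_zero_iff_closedLoop (hM : ∀ t < S.T, IsUnit (S.innovCov t))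
    (γU : ControlPolicy m p M) (γΘ : SelectorPolicy p M) : selExcess noise γΘ = 0 ↔
    ∀ t < S.T, ∀ᵐ ω ∂P, S.c t ((S.closedLoop noise γU γΘ t).sel ω) = ⨅ i, S.c t i := by
  rw [selExcess_eq_zero_iff]
  refine forall_congr' fun t => imp_congr_right fun ht => Filter.eventually_congr ?_
  filter_upwards [ae_sel_eq noise γU γΘ hM ht] with ω hω
  rw [hω]

end Loop

end Problem

end QFLQG

open QFLQG in
theorem theorem2 {n m p M : ℕ} (S : Problem n m p M)
    {Ω : Type*} [MeasurableSpace Ω] (P : Measure Ω) [IsProbabilityMeasure P]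
    (noise : Noise S P) (hM : ∀ t < S.T, IsUnit (S.innovCov t)) :
    (∀ t < S.T, ∀ j : Fin M,
      S.IsOptimalQuantizer noise t j ↔ S.c t j = ⨅ i, S.c t i) ∧
    (∀ γΘ : SelectorPolicy p M,
      (∃ γU : ControlPolicy m p M, S.IsOptimal noise γU γΘ) ↔
        ∀ (γU : ControlPolicy m p M), ∀ t < S.T,
          ∀ᵐ ω ∂P, S.c t ((S.closedLoop noise γU γΘ t).sel ω) = ⨅ i, S.c t i) := by
  refine ⟨fun t ht j => ?_, fun γΘ => ?_⟩
  · have : Nonempty (Fin M) := ⟨j⟩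
    constructor
    · rintro ⟨γU, γΘ, hopt, hj⟩
      have h := (Problem.selExcess_eq_zero_iff_closedLoop noise hM γU γΘ).1
        ((Problem.isOptimal_iff noise hM γU γΘ).1 hopt).2 t ht
      obtain ⟨ω, hω, hω'⟩ := (h.and hj).exists
      rwa [hω'] at hω
    · intro hj
      obtain ⟨σ, hσ⟩ := Problem.exists_c_eq_iInf (S := S)
      have hσ' : ∀ s < S.T, S.c s (Function.update σ t j s) = ⨅ i, S.c s i := fun s _ => by
        rcases eq_or_ne s t with rfl | hs
        · simpa using hj
        · rw [Function.update_of_ne hs, hσ]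
      refine ⟨S.certainty, Problem.openLoop (Function.update σ t j),
        (Problem.isOptimal_iff noise hM _ _).2 ⟨Problem.ctrlExcess_certainty noise _,
          Problem.selExcess_openLoop noise hσ'⟩, .of_forall fun ω => ?_⟩
      rw [(Problem.closedLoop_sel_O noise _ _ t ω).1, Problem.selOf_openLoop]
      simp
  · have : Nonempty (Fin M) := ⟨γΘ.act 0 (fun s => s.elim0, fun s => s.elim0)⟩
    constructor
    · rintro ⟨γU, hopt⟩ γU'
      exact (Problem.selExcess_eq_zero_iff_closedLoop noise hM γU' γΘ).1
        ((Problem.isOptimal_iff noise hM γU γΘ).1 hopt).2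
    · intro h
      exact ⟨S.certainty, (Problem.isOptimal_iff noise hM _ _).2
        ⟨Problem.ctrlExcess_certainty noise γΘ,
          (Problem.selExcess_eq_zero_iff_closedLoop noise hM _ γΘ).2 (h S.certainty)⟩⟩
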